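/- **Theorem 3.14.** Let $K$ be a field, $d\ge 4$, and let $v_1,\dots,v_d\in K^2$ (indices modulo $d$) be the consecutive vertices of a polygon. Put $\mathbf v_i=(v_i,1)\in K^3$, $\mathbf n_i=\mathbf v_i\times\mathbf v_{i+1}$, $\ell_i=\mathbf n_i\cdot(x,y,z)$, $\alpha_i=\det(\mathbf v_{i-1},\mathbf v_i,\mathbf v_{i+1})$, and $b_i=\alpha_i\prod_{j\ne i-1,i}\ell_j$. Assume that no three of the lines $\mathbb V(\ell_1),\dots,\mathbb V(\ell_d)\subseteq\mathbb P^2$ meet at a point. Let $S=K[x_1,\dots,x_d]$ and $\mathbb P^{d-1}=\operatorname{Proj} S$ with the Zariski topology, and let the Wachspress surface $W_d\subseteq\mathbb P^{d-1}$ be the closure of the image of the rational map $\mathbb P^2\dashrightarrow\mathbb P^{d-1}$ given on the chart $z\neq 0$ by $(x,y)\mapsto[b_1(x,y,1):\dots:b_d(x,y,1)]$ (as a map of schemes). Let $I_{W_d}\subseteq S$ be the homogeneous ideal of polynomials vanishing on $W_d$, let $(I_{W_d})_2$ be its degree-two part (the Wachspress quadrics), and let the center $\mathcal C\subseteq\mathbb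 P^{d-1}$ be the linear subspace defined by the three components of $\tau=\sum_{i=1}^d x_i\mathbf v_i$. Then $\mathbb V(\langle (I_{W_d})_2\rangle)\setminus\mathcal C\subseteq W_d$. Moreover $$\mathbb V(\langle (I_{W_d})_2\rangle)=W_d\cup\mathcal C ,$$ where $W_d$ and $\mathcal C$ are irreducible closed sets and $W_d\not\subseteq\mathcal C$. If $d\ge 6$, then also $\mathcal C\not\subseteq W_d$, and the irreducible components of $\mathbb V(\langle (I_{W_d})_2\rangle)$ are exactly $W_d$ and $\mathcal C$. -/

import Mathlib

open MvPolynomial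

attribute [local instance] MvPolynomial.gradedAlgebra

namespace Wachspress

noncomputable section

/-- The ray `(vᵢ, 1)` in `K³` over the `i`-th vertex; indices are taken modulo `d`. -/
def ray {K : Type*} [Field K] {d : ℕ} (v : ZMod d → Fin 2 → K) (i : ZMod d) : Fin 3 → K :=
  ![v i 0, v i 1, 1]

/-- The normal vector of the facet over the edge `[vⱼ, vⱼ₊₁]`. -/
def normal {K : Type*} [Field K] {d : ℕ} (v : ZMod d → Fin 2 → K) (j : ZMod d) : Fin 3 → K :=
  crossProduct (ray v j) (ray v (j + 1))

/-- The determinant `αⱼ = |vⱼ₋₁ vⱼ vⱼ₊₁|` of three consecutive rays. -/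
def alpha {K : Type*} [Field K] {d : ℕ} (v : ZMod d → Fin 2 → K) (j : ZMod d) : K :=
  Matrix.det (Matrix.of ![ray v (j - 1), ray v j, ray v (j + 1)])

/-- The linear form `ℓⱼ = nⱼ · (x, y, z)` defining the edge line through `vⱼ` and `vⱼ₊₁`. -/
def edgeForm {K : Type*} [Field K] {d : ℕ} (v : ZMod d → Fin 2 → K) (j : ZMod d) :
    MvPolynomial (Fin 3) K :=
  ∑ k : Fin 3, C (normal v j k) * X k

/-- No three of the `d` edge lines `V(ℓⱼ) ⊆ ℙ²` meet at a point of `ℙ²`. -/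
def NoThreeConcurrent {K : Type*} [Field K] {d : ℕ} (v : ZMod d → Fin 2 → K) : Prop :=
  ∀ i j k : ZMod d, i ≠ j → i ≠ k → j ≠ k → ∀ p : Fin 3 → K, p ≠ 0 →
    ¬ (eval p (edgeForm v i) = 0 ∧ eval p (edgeForm v j) = 0 ∧ eval p (edgeForm v k) = 0)

/-- The (homogenized) numerator `bᵢ = αᵢ ∏_{j ≠ i-1, i} ℓⱼ` of the `i`-th Wachspress coordinate. -/
def numerator {K : Type*} [Field K] {d : ℕ} [NeZero d] (v : ZMod d → Fin 2 → K) (i : ZMod d) :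
    MvPolynomial (Fin 3) K :=
  C (alpha v i) * ∏ j ∈ Finset.univ \ {i - 1, i}, edgeForm v j

/-- The restriction of `bᵢ` to the affine chart `z = 1` of `ℙ²`. -/
def affineNumerator {K : Type*} [Field K] {d : ℕ} [NeZero d] (v : ZMod d → Fin 2 → K)
    (i : ZMod d) : MvPolynomial (Fin 2) K :=
  aeval ![X 0, X 1, 1] (numerator v i)

/-- The pullback `f ↦ f(b₁, …, b_d)` along the affine Wachspress map. -/
def pullback {K : Type*} [Field K] {d : ℕ} [NeZero d] (v : ZMod d → Fin 2 → K) :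
    MvPolynomial (ZMod d) K →ₐ[K] MvPolynomial (Fin 2) K :=
  aeval (affineNumerator v)

/-- `ℙ^{d-1} = Proj K[x₁, …, x_d]` with its Zariski topology. -/
abbrev ProjSpace (K : Type*) [Field K] (d : ℕ) :=
  ProjectiveSpectrum (homogeneousSubmodule (ZMod d) K)

/-- The points of the chart `𝔸² = {z ≠ 0} ⊆ ℙ²` that are not common zeros of all the `bᵢ`. -/
def regularLocus {K : Type*} [Field K] {d : ℕ} [NeZero d] (v : ZMod d → Fin 2 → K) :
    Set (PrimeSpectrum (MvPolynomial (Fin 2) K)) :=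
  {p | ∃ i, affineNumerator v i ∉ p.asIdeal}

/-- The Wachspress map `p ↦ [b₁(p) : ⋯ : b_d(p)]` on the points of the chart `z ≠ 0` where
some `bᵢ` is nonzero: the image of `p` is the homogeneous prime generated by the homogeneous
`f` for which `f(b₁, …, b_d)` vanishes at `p`. -/
def wachspressMap {K : Type*} [Field K] {d : ℕ} [NeZero d] (v : ZMod d → Fin 2 → K)
    (p : regularLocus v) : ProjSpace K d where
  asHomogeneousIdeal :=
    (Ideal.comap (pullback v) p.1.asIdeal).homogeneousCore (homogeneousSubmodule (ZMod d) K)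
  isPrime := (Ideal.IsPrime.comap (pullback v)).homogeneousCore
  not_irrelevant_le := by
    obtain ⟨p, i, hi⟩ := p
    intro h
    have hX : (X i : MvPolynomial (ZMod d) K) ∈
        HomogeneousIdeal.irrelevant (homogeneousSubmodule (ZMod d) K) := by
      rw [HomogeneousIdeal.mem_irrelevant_iff, GradedRing.proj_apply,
        DirectSum.decompose_of_mem_ne _ (isHomogeneous_X K i) one_ne_zero]
    have h2 := Ideal.toIdeal_homogeneousCore_le _ _ (h hX)
    exact hi (by simpa [pullback] using h2)

/-- The Wachspress surface `W_d`: the closure of the image of the Wachspress map. -/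
def surface {K : Type*} [Field K] {d : ℕ} [NeZero d] (v : ZMod d → Fin 2 → K) :
    Set (ProjSpace K d) :=
  closure (Set.range (wachspressMap v))

/-- The Wachspress quadrics `(I_{W_d})₂`: the degree-two part of the ideal of all polynomials
vanishing on `W_d`. -/
def quadrics {K : Type*} [Field K] {d : ℕ} [NeZero d] (v : ZMod d → Fin 2 → K) :
    Set (MvPolynomial (ZMod d) K) :=
  {f | f ∈ ProjectiveSpectrum.vanishingIdeal (surface v) ∧ f.IsHomogeneous 2}

/-- The zero set `V(⟨(I_{W_d})₂⟩)` of the ideal generated by the Wachspress quadrics. -/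
def quadricLocus {K : Type*} [Field K] {d : ℕ} [NeZero d] (v : ZMod d → Fin 2 → K) :
    Set (ProjSpace K d) :=
  ProjectiveSpectrum.zeroLocus _ (Ideal.span (quadrics v) : Set (MvPolynomial (ZMod d) K))

/-- The linear forms `τ₁, τ₂, τ₃`: the components of `∑ᵢ xᵢ (vᵢ, 1)`. -/
def tau {K : Type*} [Field K] {d : ℕ} [NeZero d] (v : ZMod d → Fin 2 → K) (k : Fin 3) :
    MvPolynomial (ZMod d) K :=
  ∑ i, C (ray v i k) * X i

/-- The center of the projection `τ : ℙ^{d-1} ⇢ ℙ²`. -/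
def center {K : Type*} [Field K] {d : ℕ} [NeZero d] (v : ZMod d → Fin 2 → K) :
    Set (ProjSpace K d) :=
  ProjectiveSpectrum.zeroLocus _ (Set.range (tau v))

end

end Wachspress

namespace Wachspress

/-! Linear precision makes `∑ bᵢ(q) (vᵢ, 1)` proportional to `q`, so `τ` inverts the Wachspress map.
Since `bᵢ ℓᵢ₋₁ / αᵢ` and `bᵢ₊₁ ℓᵢ₊₁ / αᵢ₊₁` are both `∏_{j ≠ i} ℓⱼ`, points `x` of the image of `q`
satisfy `αᵢ₊₁ xᵢ ℓᵢ₋₁(q) = αᵢ xᵢ₊₁ ℓᵢ₊₁(q)`. Putting `q = τ(x)` gives quadrics through the surface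
(`quadricForm`). Off the center, a point of the quadric locus therefore satisfies these relations
over `p = τ(x) ≠ 0`, and `eval_eq_zero_of_relations` places it on the surface: either the relations
force `x` to be a multiple of `b(p)`, or `p` is a base point, the meet of two nonadjacent edge
lines, and `x` is a limit of values of `b` near `p`.

Conversely, every quadric through the surface vanishes on the center. For nonadjacent edges the
linear relation among the four end rays lies on both the center and the surface
(`eval_edgeRelation_eq_zero`). Polarization spreads the vanishing from these vectors to all of `ker
τ`, by induction on the length of a supporting interval (`eval_eq_zero_of_support_interval`).

The surface and the center are closures of single points, hence irreducible. For `d ≥ 6` a `3 × 3`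
minor of the relations, read as linear equations in `q`, is a cubic vanishing on the surface but not
on the center (`exists_cubic_eval_ne_zero`). Points of `Proj` are treated as vectors over an
extension field, to which the hypothesis on the lines transfers. -/

theorem natCast_zmod_ne_zero {d n : ℕ} (h0 : 0 < n) (hn : n < d) : (n : ZMod d) ≠ 0 := by
  rw [Ne, ZMod.natCast_eq_zero_iff]
  exact Nat.not_dvd_of_pos_of_lt h0 hn

/-! ### Edge forms, rays and linear relations among the rays. -/

section Field

variable {K : Type*} [Field K] {d : ℕ}

/-- The value of the linear form `ℓⱼ` at a vector of `K³`. -/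
def edgeValue (v : ZMod d → Fin 2 → K) (j : ZMod d) (q : Fin 3 → K) : K :=
  normal v j ⬝ᵥ q

theorem eval_edgeForm (v : ZMod d → Fin 2 → K) (j : ZMod d) (q : Fin 3 → K) :
    eval q (edgeForm v j) = edgeValue v j q := by
  simp [edgeForm, edgeValue, dotProduct]

theorem isHomogeneous_edgeForm (v : ZMod d → Fin 2 → K) (j : ZMod d) :
    (edgeForm v j).IsHomogeneous 1 :=
  IsHomogeneous.sum _ _ _ fun _ _ => isHomogeneous_C_mul_X _ _

theorem edgeValue_ray_self (v : ZMod d → Fin 2 → K) (j : ZMod d) :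
    edgeValue v j (ray v j) = 0 := by
  simp [edgeValue, normal, ray, crossProduct, dotProduct, Fin.sum_univ_three]; ring

theorem edgeValue_ray_add_one (v : ZMod d → Fin 2 → K) (j : ZMod d) :
    edgeValue v j (ray v (j + 1)) = 0 := by
  simp [edgeValue, normal, ray, crossProduct, dotProduct, Fin.sum_univ_three]; ring

theorem edgeValue_sub_one_ray_self (v : ZMod d → Fin 2 → K) (j : ZMod d) :
    edgeValue v (j - 1) (ray v j) = 0 := by
  simpa using edgeValue_ray_add_one v (j - 1)

theorem edgeValue_sub_one_ray_add_one (v : ZMod d → Fin 2 → K) (j : ZMod d) :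
    edgeValue v (j - 1) (ray v (j + 1)) = alpha v j := by
  simp [edgeValue, normal, ray, alpha, crossProduct, dotProduct, Fin.sum_univ_three,
    Matrix.det_fin_three]; ring

theorem edgeValue_ray_sub_one (v : ZMod d → Fin 2 → K) (j : ZMod d) :
    edgeValue v j (ray v (j - 1)) = alpha v j := by
  simp [edgeValue, normal, ray, alpha, crossProduct, dotProduct, Fin.sum_univ_three,
    Matrix.det_fin_three]; ring

theorem edgeValue_add_one_ray_self (v : ZMod d → Fin 2 → K) (j : ZMod d) :
    edgeValue v (j + 1) (ray v j) = alpha v (j + 1) := by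
  simpa using edgeValue_ray_sub_one v (j + 1)

/-- Adjacent edge lines meet at the common vertex: `nᵢ₋₁ × nᵢ = αᵢ (vᵢ, 1)`. Hence the hypothesis on
the lines yields both `αᵢ ≠ 0` and `ℓₖ(vᵢ) ≠ 0` for the other edges. -/
theorem det_normal (v : ZMod d → Fin 2 → K) (i k : ZMod d) :
    Matrix.det (Matrix.of ![normal v (i - 1), normal v i, normal v k]) =
      alpha v i * edgeValue v k (ray v i) := by
  have h : normal v (i - 1) = crossProduct (ray v (i - 1)) (ray v i) := by
    simp [normal]
  rw [h]
  simp [normal, edgeValue, ray, alpha, crossProduct, dotProduct, Fin.sum_univ_three,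
    Matrix.det_fin_three]; ring

theorem NoThreeConcurrent.det_ne_zero {v : ZMod d → Fin 2 → K} (hv : NoThreeConcurrent v)
    {i j k : ZMod d} (hij : i ≠ j) (hik : i ≠ k) (hjk : j ≠ k) :
    Matrix.det (Matrix.of ![normal v i, normal v j, normal v k]) ≠ 0 := by
  intro h
  obtain ⟨p, hp, hp0⟩ := Matrix.exists_mulVec_eq_zero_iff.2 h
  refine hv i j k hij hik hjk p hp ?_
  simp only [eval_edgeForm]
  exact ⟨congrFun hp0 0, congrFun hp0 1, congrFun hp0 2⟩

theorem noThreeConcurrent_of_det_ne_zero {v : ZMod d → Fin 2 → K}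
    (h : ∀ i j k : ZMod d, i ≠ j → i ≠ k → j ≠ k →
      Matrix.det (Matrix.of ![normal v i, normal v j, normal v k]) ≠ 0) :
    NoThreeConcurrent v := by
  intro i j k hij hik hjk p hp h3
  simp only [eval_edgeForm] at h3
  refine h i j k hij hik hjk (Matrix.exists_mulVec_eq_zero_iff.1 ⟨p, hp, ?_⟩)
  funext l
  fin_cases l
  exacts [h3.1, h3.2.1, h3.2.2]

theorem NoThreeConcurrent.edgeValue_ne_zero {v : ZMod d → Fin 2 → K} (hv : NoThreeConcurrent v)
    {i j k : ZMod d} (hij : i ≠ j) (hik : i ≠ k) (hjk : j ≠ k) {p : Fin 3 → K} (hp : p ≠ 0)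
    (hi : edgeValue v i p = 0) (hj : edgeValue v j p = 0) : edgeValue v k p ≠ 0 := by
  intro hk
  refine hv i j k hij hik hjk p hp ?_
  simp only [eval_edgeForm]
  exact ⟨hi, hj, hk⟩

variable {v : ZMod d → Fin 2 → K}

theorem NoThreeConcurrent.alpha_mul_edgeValue_ne_zero (hd : 4 ≤ d) (hv : NoThreeConcurrent v)
    {i k : ZMod d} (h1 : k ≠ i - 1) (h2 : k ≠ i) : alpha v i * edgeValue v k (ray v i) ≠ 0 := by
  rw [← det_normal]
  refine hv.det_ne_zero ?_ h1.symm h2.symm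
  have := natCast_zmod_ne_zero (d := d) (n := 1) (by omega) (by omega)
  intro h
  apply this
  push_cast
  linear_combination -h

theorem NoThreeConcurrent.edgeValue_ray_ne_zero (hd : 4 ≤ d) (hv : NoThreeConcurrent v)
    {i k : ZMod d} (h1 : k ≠ i - 1) (h2 : k ≠ i) : edgeValue v k (ray v i) ≠ 0 :=
  right_ne_zero_of_mul (hv.alpha_mul_edgeValue_ne_zero hd h1 h2)

theorem NoThreeConcurrent.alpha_ne_zero (hd : 4 ≤ d) (hv : NoThreeConcurrent v)
    (i : ZMod d) : alpha v i ≠ 0 := by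
  refine left_ne_zero_of_mul (hv.alpha_mul_edgeValue_ne_zero hd (k := i + 1) ?_ ?_)
  · have := natCast_zmod_ne_zero (d := d) (n := 2) (by omega) (by omega)
    intro h
    apply this
    push_cast
    linear_combination h
  · have := natCast_zmod_ne_zero (d := d) (n := 1) (by omega) (by omega)
    intro h
    apply this
    push_cast
    linear_combination h

variable [NeZero d]

/-- The image `∑ᵢ xᵢ (vᵢ, 1)` of `x` under the projection `τ`. -/
def tauVec (v : ZMod d → Fin 2 → K) (x : ZMod d → K) : Fin 3 → K :=
  ∑ i, x i • ray v i

theorem eval_tau (v : ZMod d → Fin 2 → K) (x : ZMod d → K) (k : Fin 3) :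
    eval x (tau v k) = tauVec v x k := by
  simp [tau, tauVec, mul_comm]

theorem edgeValue_tauVec (v : ZMod d → Fin 2 → K) (x : ZMod d → K) (j : ZMod d) :
    edgeValue v j (tauVec v x) = ∑ i, x i * edgeValue v j (ray v i) := by
  simp [edgeValue, tauVec, dotProduct_sum]

theorem tauVec_add (v : ZMod d → Fin 2 → K) (x y : ZMod d → K) :
    tauVec v (x + y) = tauVec v x + tauVec v y := by
  simp [tauVec, add_smul, Finset.sum_add_distrib]

theorem tauVec_smul (v : ZMod d → Fin 2 → K) (c : K) (x : ZMod d → K) :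
    tauVec v (c • x) = c • tauVec v x := by
  simp [tauVec, Finset.smul_sum, mul_smul]

theorem tauVec_single (v : ZMod d → Fin 2 → K) (i : ZMod d) (c : K) :
    tauVec v (Pi.single i c) = c • ray v i := by
  rw [tauVec, Finset.sum_eq_single i] <;> simp +contextual

/-- The linear relation between the rays at the end points of the edges `m` and `n`. -/
def edgeRelation (v : ZMod d → Fin 2 → K) (m n : ZMod d) : ZMod d → K :=
  Pi.single m (edgeValue v n (ray v (m + 1))) + Pi.single (m + 1) (-edgeValue v n (ray v m)) +
    (Pi.single n (edgeValue v m (ray v (n + 1))) + Pi.single (n + 1) (-edgeValue v m (ray v n)))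

theorem tauVec_edgeRelation (v : ZMod d → Fin 2 → K) (m n : ZMod d) :
    tauVec v (edgeRelation v m n) = 0 := by
  simp only [edgeRelation, tauVec_add, tauVec_single]
  funext k
  fin_cases k <;>
  simp [edgeValue, normal, ray, crossProduct, dotProduct, Fin.sum_univ_three] <;> ring

end Field

/-! ### The parametrization -/

section Parametrization

variable {K : Type*} [Field K] {d : ℕ} [NeZero d]

theorem aeval_numerator {R : Type*} [CommRing R] [Algebra K R] (v : ZMod d → Fin 2 → K)
    (q : Fin 3 → R) (k : ZMod d) :
    aeval q (numerator v k) =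
      algebraMap K R (alpha v k) * ∏ j ∈ Finset.univ \ {k - 1, k}, aeval q (edgeForm v j) := by
  simp [numerator]

theorem aeval_smul_of_isHomogeneous {σ R S : Type*} [CommRing R] [CommRing S] [Algebra R S]
    {f : MvPolynomial σ R} {n : ℕ} (hf : f.IsHomogeneous n) (c : S) (x : σ → S) :
    aeval (c • x) f = c ^ n * aeval x f := by
  rw [aeval_def, aeval_def, eval₂_eq, eval₂_eq, Finset.mul_sum]
  refine Finset.sum_congr rfl fun e he => ?_
  rw [hf.degree_eq_sum_deg_support he]
  simp only [Pi.smul_apply, smul_eq_mul, mul_pow, Finset.prod_mul_distrib,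
    Finset.prod_pow_eq_pow_sum]
  ring

theorem isHomogeneous_numerator (hd : 4 ≤ d) (v : ZMod d → Fin 2 → K) (j : ZMod d) :
    (numerator v j).IsHomogeneous (d - 2) := by
  refine IsHomogeneous.C_mul ?_ _
  have h := IsHomogeneous.prod (Finset.univ \ {j - 1, j}) (edgeForm v) (fun _ => 1)
    fun i _ => isHomogeneous_edgeForm v i
  convert h using 1
  have h1 := natCast_zmod_ne_zero (d := d) (n := 1) (by omega) (by omega)
  have : j - 1 ≠ j := fun h => h1 (by push_cast; linear_combination -h)
  rw [Finset.sum_const, Finset.card_sdiff_of_subset (Finset.subset_univ _), Finset.card_univ,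
    ZMod.card, Finset.card_pair this]
  simp

/-- The pullback only sees the chart `z = 1`. Over the fraction field `(x, y, z) = z · (x/z, y/z,
1)`, and homogeneity of the numerators and of `f` turns the factor `z` into a power. With `R`
arbitrary, `q` may lie on the line `z = 0` or be a polynomial curve. -/
theorem aeval_numerator_eq_zero (hd : 4 ≤ d) (v : ZMod d → Fin 2 → K)
    {f : MvPolynomial (ZMod d) K} {n : ℕ} (hf : f.IsHomogeneous n) (h0 : pullback v f = 0)
    {R : Type*} [CommRing R] [Algebra K R] (q : Fin 3 → R) :
    aeval (fun k => aeval q (numerator v k)) f = 0 := by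
  suffices h : aeval (numerator v) f = 0 by
    have h2 := congrArg (aeval q) h
    rwa [map_zero, ← AlgHom.comp_apply, comp_aeval] at h2
  let F := FractionRing (MvPolynomial (Fin 3) K)
  have inj : Function.Injective (algebraMap (MvPolynomial (Fin 3) K) F) :=
    IsFractionRing.injective _ _
  apply inj
  let z : F := algebraMap (MvPolynomial (Fin 3) K) F (X 2)
  have hz : z ≠ 0 := (map_ne_zero_iff _ inj).2 (X_ne_zero (R := K) (2 : Fin 3))
  let w : Fin 3 → F := ![algebraMap (MvPolynomial (Fin 3) K) F (X 0) / z,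
    algebraMap (MvPolynomial (Fin 3) K) F (X 1) / z, 1]
  have hw : algebraMap (MvPolynomial (Fin 3) K) F ∘ X = z • w := by
    funext i
    fin_cases i
    exacts [(mul_div_cancel₀ _ hz).symm, (mul_div_cancel₀ _ hz).symm, (mul_one z).symm]
  have hnum : algebraMap (MvPolynomial (Fin 3) K) F ∘ numerator v =
      z ^ (d - 2) • fun k => aeval w (numerator v k) := by
    funext k
    have : algebraMap (MvPolynomial (Fin 3) K) F (numerator v k) =
        aeval (algebraMap (MvPolynomial (Fin 3) K) F ∘ X) (numerator v k) := by
      rw [aeval_algebraMap_apply, aeval_X_left_apply]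
    rw [Function.comp_apply, this, hw, aeval_smul_of_isHomogeneous (isHomogeneous_numerator hd v k)]
    simp
  have haff : (fun k => aeval w (numerator v k)) = fun k =>
      aeval ![w 0, w 1] (affineNumerator v k) := by
    funext k
    rw [affineNumerator, ← AlgHom.comp_apply, comp_aeval]
    congr 2
    funext i
    fin_cases i <;> simp [w]
  rw [map_zero, ← aeval_algebraMap_apply, hnum, aeval_smul_of_isHomogeneous hf, haff]
  have : aeval (fun k => aeval ![w 0, w 1] (affineNumerator v k)) f =
      aeval ![w 0, w 1] (pullback v f) := by
    rw [pullback, ← AlgHom.comp_apply, comp_aeval]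
  rw [this, h0, map_zero, mul_zero]

theorem prod_erase_eq_mul_sub_one (hd : 4 ≤ d) {R : Type*} [CommRing R] (g : ZMod d → R)
    (k : ZMod d) : ∏ j ∈ Finset.univ.erase k, g j =
      (∏ j ∈ Finset.univ \ {k - 1, k}, g j) * g (k - 1) := by
  have h1 := natCast_zmod_ne_zero (d := d) (n := 1) (by omega) (by omega)
  have hk : k - 1 ≠ k := fun h => h1 (by push_cast; linear_combination -h)
  rw [← Finset.prod_erase_mul (Finset.univ.erase k) _
    (Finset.mem_erase.2 ⟨hk, Finset.mem_univ _⟩)]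
  congr 2
  ext j; simp

theorem prod_erase_sub_one_eq_mul (hd : 4 ≤ d) {R : Type*} [CommRing R] (g : ZMod d → R)
    (k : ZMod d) : ∏ j ∈ Finset.univ.erase (k - 1), g j =
      (∏ j ∈ Finset.univ \ {k - 1, k}, g j) * g k := by
  have h1 := natCast_zmod_ne_zero (d := d) (n := 1) (by omega) (by omega)
  have hk : k ≠ k - 1 := fun h => h1 (by push_cast; linear_combination h)
  rw [← Finset.prod_erase_mul (Finset.univ.erase (k - 1)) _
    (Finset.mem_erase.2 ⟨hk, Finset.mem_univ _⟩)]
  congr 2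
  ext j; simp [and_comm]

theorem aeval_numerator_mul_sub_one (hd : 4 ≤ d) (v : ZMod d → Fin 2 → K)
    {R : Type*} [CommRing R] [Algebra K R] (q : Fin 3 → R) (k : ZMod d) :
    aeval q (numerator v k) * aeval q (edgeForm v (k - 1)) =
      algebraMap K R (alpha v k) * ∏ j ∈ Finset.univ.erase k, aeval q (edgeForm v j) := by
  rw [aeval_numerator, mul_assoc, prod_erase_eq_mul_sub_one hd]

theorem aeval_numerator_mul_self (hd : 4 ≤ d) (v : ZMod d → Fin 2 → K)
    {R : Type*} [CommRing R] [Algebra K R] (q : Fin 3 → R) (k : ZMod d) :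
    aeval q (numerator v k) * aeval q (edgeForm v k) =
      algebraMap K R (alpha v k) * ∏ j ∈ Finset.univ.erase (k - 1), aeval q (edgeForm v j) := by
  rw [aeval_numerator, mul_assoc, prod_erase_sub_one_eq_mul hd]

/-- Both sides are `αₖ αₖ₊₁ ∏_{j ≠ k} ℓⱼ(q)`. -/
theorem aeval_numerator_relation (hd : 4 ≤ d) (v : ZMod d → Fin 2 → K)
    {R : Type*} [CommRing R] [Algebra K R] (q : Fin 3 → R) (k : ZMod d) :
    algebraMap K R (alpha v (k + 1)) * aeval q (numerator v k) * aeval q (edgeForm v (k - 1)) =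
      algebraMap K R (alpha v k) * aeval q (numerator v (k + 1)) *
        aeval q (edgeForm v (k + 1)) := by
  rw [mul_assoc, aeval_numerator_mul_sub_one hd, mul_assoc, aeval_numerator_mul_self hd,
    add_sub_cancel_right]
  ring

end Parametrization

/-! ### Vectors satisfying the Wachspress relations lie on the surface. -/

section Surface

variable {K : Type*} [Field K] {d : ℕ} {v : ZMod d → Fin 2 → K}

theorem aeval_edgeForm_line (v : ZMod d → Fin 2 → K) (j : ZMod d) (p w : Fin 3 → K) :
    aeval (fun i => Polynomial.C (p i) + Polynomial.X * Polynomial.C (w i)) (edgeForm v j) =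
      Polynomial.C (edgeValue v j p) + Polynomial.X * Polynomial.C (edgeValue v j w) := by
  simp [edgeForm, edgeValue, dotProduct, Fin.sum_univ_three, Polynomial.algebraMap_eq]
  ring

theorem NoThreeConcurrent.exists_edgeValue_eq (hd : 4 ≤ d) (hv : NoThreeConcurrent v)
    {m n : ZMod d} (hmn : m ≠ n) (h1 : n ≠ m + 1) (s t : K) :
    ∃ w : Fin 3 → K, edgeValue v m w = s ∧ edgeValue v n w = t := by
  have hm : m ≠ m + 1 := fun h => natCast_zmod_ne_zero (d := d) (n := 1) (by omega) (by omega)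
    (by push_cast; linear_combination -h)
  have hdet := hv.det_ne_zero hmn hm h1
  refine ⟨(Matrix.of ![normal v m, normal v n, normal v (m + 1)])⁻¹.mulVec ![s, t, 0], ?_⟩
  have h := Matrix.mulVec_mulVec ![s, t, 0]
    (Matrix.of ![normal v m, normal v n, normal v (m + 1)])
    (Matrix.of ![normal v m, normal v n, normal v (m + 1)])⁻¹
  rw [Matrix.mul_nonsing_inv _ hdet.isUnit, Matrix.one_mulVec] at h
  exact ⟨congrFun h 0, congrFun h 1⟩

variable [NeZero d]

/-- The points of the line over the base point `p = V(ℓₘ) ∩ V(ℓₙ)` of the Wachspress map lie on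
the Wachspress surface: they are limits of `b(p + εw)` as `ε → 0`. -/
theorem eval_eq_zero_of_base_point (hd : 4 ≤ d) (hv : NoThreeConcurrent v)
    {m n : ZMod d} (hmn : m ≠ n) (h1 : n ≠ m + 1) (h2 : m ≠ n + 1) {p : Fin 3 → K} (hp : p ≠ 0)
    (hm : edgeValue v m p = 0) (hn : edgeValue v n p = 0) {x : ZMod d → K}
    (hx : ∀ k, k ≠ m → k ≠ m + 1 → k ≠ n → k ≠ n + 1 → x k = 0)
    (hxm : alpha v (m + 1) * x m * edgeValue v (m - 1) p =
      alpha v m * x (m + 1) * edgeValue v (m + 1) p)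
    (hxn : alpha v (n + 1) * x n * edgeValue v (n - 1) p =
      alpha v n * x (n + 1) * edgeValue v (n + 1) p)
    {f : MvPolynomial (ZMod d) K} {N : ℕ} (hf : f.IsHomogeneous N) (h0 : pullback v f = 0) :
    eval x f = 0 := by
  have one_ne : (1 : ZMod d) ≠ 0 := by
    simpa using natCast_zmod_ne_zero (d := d) (n := 1) (by omega) (by omega)
  have hne : ∀ j, j ≠ m → j ≠ n → edgeValue v j p ≠ 0 := fun j hjm hjn =>
    hv.edgeValue_ne_zero hmn hjm.symm hjn.symm hp hm hn
  set P : K := ∏ j ∈ (Finset.univ.erase m).erase n, edgeValue v j p with hP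
  have hP0 : P ≠ 0 := Finset.prod_ne_zero_iff.2 fun j hj => by
    simp only [Finset.mem_erase] at hj
    exact hne j hj.2.1 hj.1
  -- The coefficient of `ε` in `bₘ(p + εw)` is `αₘ P ℓₙ(w) / ℓₘ₋₁(p)`, and symmetrically for `bₙ`.
  -- The direction `w` is chosen so that these coefficients are `xₘ` and `xₙ`.
  obtain ⟨w, hwm, hwn⟩ := hv.exists_edgeValue_eq hd hmn h1
    (x n * edgeValue v (n - 1) p / (alpha v n * P)) (x m * edgeValue v (m - 1) p / (alpha v m * P))
  set q : Fin 3 → Polynomial K :=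
    fun i => Polynomial.C (p i) + Polynomial.X * Polynomial.C (w i) with hq
  have hell : ∀ j, aeval q (edgeForm v j) =
      Polynomial.C (edgeValue v j p) + Polynomial.X * Polynomial.C (edgeValue v j w) :=
    fun j => aeval_edgeForm_line v j p w
  -- As `m` and `n` are not adjacent, no numerator omits both `ℓₘ` and `ℓₙ`. The quotients `δ` at
  -- `0` give the limit point.
  have hdvd : ∀ k, ∃ δ, aeval q (numerator v k) = Polynomial.X * δ := by
    intro k
    have aux : ∀ j, edgeValue v j p = 0 → j ≠ k - 1 → j ≠ k →
        ∃ δ, aeval q (numerator v k) = Polynomial.X * δ := by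
      intro j hj hj1 hj2
      rw [aeval_numerator]
      refine Dvd.dvd.mul_left (Dvd.dvd.trans ?_ (Finset.dvd_prod_of_mem _ (a := j) ?_)) _
      · rw [hell, hj]; simp
      · simp [hj1, hj2]
    by_cases hkm : m ≠ k - 1 ∧ m ≠ k
    · exact aux m hm hkm.1 hkm.2
    · refine aux n hn ?_ ?_
      · rintro rfl
        apply hkm
        refine ⟨hmn, ?_⟩
        simpa using h2
      · rintro rfl
        apply hkm
        refine ⟨?_, hmn⟩
        rintro rfl
        simp at h1
  choose δ hδ using hdvd
  have hrel : ∀ k, alpha v (k + 1) * (δ k).eval 0 * edgeValue v (k - 1) p =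
      alpha v k * (δ (k + 1)).eval 0 * edgeValue v (k + 1) p := by
    intro k
    have h := aeval_numerator_relation hd v q k
    rw [hδ, hδ, hell, hell, Polynomial.algebraMap_eq] at h
    have h' := mul_left_cancel₀ (Polynomial.X_ne_zero (R := K))
      (show Polynomial.X * (Polynomial.C (alpha v (k + 1)) * δ k *
        (Polynomial.C (edgeValue v (k - 1) p) + Polynomial.X * Polynomial.C (edgeValue v (k - 1) w)))
        = Polynomial.X * (Polynomial.C (alpha v k) * δ (k + 1) *
        (Polynomial.C (edgeValue v (k + 1) p) + Polynomial.X * Polynomial.C (edgeValue v (k + 1) w)))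
        by linear_combination h)
    simpa using congrArg (Polynomial.eval 0) h'
  have key : ∀ a b : ZMod d, a ≠ b → edgeValue v b p = 0 → edgeValue v (a - 1) p ≠ 0 →
      edgeValue v (a + 1) p ≠ 0 → ∏ j ∈ (Finset.univ.erase a).erase b, edgeValue v j p = P →
      edgeValue v b w = x a * edgeValue v (a - 1) p / (alpha v a * P) →
      alpha v (a + 1) * x a * edgeValue v (a - 1) p = alpha v a * x (a + 1) * edgeValue v (a + 1) p →
      (δ a).eval 0 = x a ∧ (δ (a + 1)).eval 0 = x (a + 1) := by
    intro a b hab hb ha1 ha2 hPab hw hxa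
    have hα := hv.alpha_ne_zero hd a
    have h := aeval_numerator_mul_sub_one hd v q a
    rw [hδ, ← Finset.prod_erase_mul _ _ (Finset.mem_erase.2 ⟨hab.symm, Finset.mem_univ b⟩),
      hell b, hb, Polynomial.algebraMap_eq] at h
    have h' := mul_left_cancel₀ (Polynomial.X_ne_zero (R := K))
      (show Polynomial.X * (δ a * aeval q (edgeForm v (a - 1))) =
        Polynomial.X * (Polynomial.C (alpha v a) *
        (∏ j ∈ (Finset.univ.erase a).erase b, aeval q (edgeForm v j)) *
          Polynomial.C (edgeValue v b w)) by
        rw [map_zero] at h; linear_combination h)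
    have h'' := congrArg (Polynomial.eval 0) h'
    simp only [hell, Polynomial.eval_mul, Polynomial.eval_add, Polynomial.eval_C,
      Polynomial.eval_X, zero_mul, add_zero, Polynomial.eval_prod] at h''
    rw [hPab, hw] at h''
    have e1 : (δ a).eval 0 = x a := by
      apply mul_right_cancel₀ ha1
      rw [h'']
      field_simp
    refine ⟨e1, ?_⟩
    apply mul_right_cancel₀ ha2
    apply mul_left_cancel₀ hα
    have := hrel a
    rw [e1] at this
    linear_combination hxa - this
  have hval : (fun k => (δ k).eval 0) = x := by
    have hm1 : m - 1 ≠ m := fun h => one_ne (by linear_combination -h)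
    have hm2 : m + 1 ≠ m := fun h => one_ne (by linear_combination h)
    have hn1 : n - 1 ≠ n := fun h => one_ne (by linear_combination -h)
    have hn2 : n + 1 ≠ n := fun h => one_ne (by linear_combination h)
    have hm3 : m - 1 ≠ n := fun h => h2 (by rw [← h]; ring)
    have hn3 : n - 1 ≠ m := fun h => h1 (by rw [← h]; ring)
    have km := key m n hmn hn (hne _ hm1 hm3) (hne _ hm2 h1.symm) rfl hwn hxm
    have kn := key n m hmn.symm hm (hne _ hn3 hn1) (hne _ h2.symm hn2)
      (by rw [hP, Finset.erase_right_comm]) hwm hxn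
    funext k
    by_cases k1 : k = m
    · rw [k1]; exact km.1
    by_cases k2 : k = m + 1
    · rw [k2]; exact km.2
    by_cases k3 : k = n
    · rw [k3]; exact kn.1
    by_cases k4 : k = n + 1
    · rw [k4]; exact kn.2
    rw [hx k k1 k2 k3 k4]
    -- For the remaining `k`, both `ℓₘ` and `ℓₙ` divide `bₖ`, so `bₖ` vanishes to second order and
    -- `δ k` is zero at `0`.
    have hk : k - 1 ≠ k := fun h => one_ne (by linear_combination -h)
    have h := congrArg (· * aeval q (edgeForm v k)) (aeval_numerator_mul_sub_one hd v q k)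
    beta_reduce at h
    rw [mul_assoc (algebraMap _ _ _), Finset.prod_erase_mul _ _ (Finset.mem_univ k), hδ,
      ← Finset.prod_erase_mul _ _ (Finset.mem_univ m),
      ← Finset.prod_erase_mul _ _ (Finset.mem_erase.2 ⟨hmn.symm, Finset.mem_univ n⟩),
      hell m, hell n, hm, hn, map_zero] at h
    have h' := mul_left_cancel₀ (Polynomial.X_ne_zero (R := K))
      (show Polynomial.X * (δ k * aeval q (edgeForm v (k - 1)) * aeval q (edgeForm v k)) =
        Polynomial.X * (Polynomial.X * (algebraMap K _ (alpha v k) *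
        (∏ j ∈ (Finset.univ.erase m).erase n, aeval q (edgeForm v j)) *
          Polynomial.C (edgeValue v n w) * Polynomial.C (edgeValue v m w))) by
        linear_combination h)
    have h'' := congrArg (Polynomial.eval 0) h'
    simp only [hell, Polynomial.eval_mul, Polynomial.eval_add, Polynomial.eval_C,
      Polynomial.eval_X, zero_mul, add_zero] at h''
    have e1 : edgeValue v (k - 1) p ≠ 0 :=
      hne _ (fun h => k2 (by rw [← h]; ring)) (fun h => k4 (by rw [← h]; ring))
    exact (mul_eq_zero.1 ((mul_eq_zero.1 h'').resolve_right (hne k k1 k3))).resolve_right e1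
  have hz := aeval_numerator_eq_zero hd v hf h0 q
  have hs : (fun k => aeval q (numerator v k)) = (Polynomial.X : Polynomial K) • δ := by
    funext k
    rw [hδ]; rfl
  rw [hs, aeval_smul_of_isHomogeneous hf] at hz
  have hz' := (mul_eq_zero.1 hz).resolve_left (pow_ne_zero _ Polynomial.X_ne_zero)
  have hz2 := congrArg (Polynomial.aeval (0 : K)) hz'
  rw [map_zero, ← AlgHom.comp_apply, comp_aeval] at hz2
  have hc : (fun i => (Polynomial.aeval (0 : K)) (δ i)) = x := by
    rw [← hval]
    funext i
    rw [Polynomial.coe_aeval_eq_eval]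
  rwa [hc, aeval_eq_eval] at hz2

/-- A point satisfying the Wachspress relations over a nonzero `p` lies on the surface. -/
theorem eval_eq_zero_of_relations (hd : 4 ≤ d) (hv : NoThreeConcurrent v)
    {p : Fin 3 → K} (hp : p ≠ 0) {x : ZMod d → K}
    (hx : ∀ i, alpha v (i + 1) * x i * edgeValue v (i - 1) p =
      alpha v i * x (i + 1) * edgeValue v (i + 1) p)
    {f : MvPolynomial (ZMod d) K} {N : ℕ} (hf : f.IsHomogeneous N) (h0 : pullback v f = 0) :
    eval x f = 0 := by
  have one_ne : (1 : ZMod d) ≠ 0 := by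
    simpa using natCast_zmod_ne_zero (d := d) (n := 1) (by omega) (by omega)
  have two_ne : (2 : ZMod d) ≠ 0 := by
    simpa using natCast_zmod_ne_zero (d := d) (n := 2) (by omega) (by omega)
  -- The first case says that `bₖ(p) ≠ 0` for some `k`; otherwise `p` is a base point.
  by_cases hA : ∃ k, ∀ j, j ≠ k - 1 → j ≠ k → edgeValue v j p ≠ 0
  · obtain ⟨k, hk⟩ := hA
    set b : ZMod d → K := fun k => aeval p (numerator v k) with hb
    have hbk : b k ≠ 0 := by
      change aeval p (numerator v k) ≠ 0
      rw [aeval_numerator]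
      refine mul_ne_zero ?_ (Finset.prod_ne_zero_iff.2 fun j hj => ?_)
      · simpa using hv.alpha_ne_zero hd k
      · rw [aeval_eq_eval, eval_edgeForm]
        simp at hj
        exact hk j hj.1 hj.2
    have hbr : ∀ i, alpha v (i + 1) * b i * edgeValue v (i - 1) p =
        alpha v i * b (i + 1) * edgeValue v (i + 1) p := by
      intro i
      have := aeval_numerator_relation hd v p i
      simpa [hb, aeval_eq_eval, eval_edgeForm] using this
    obtain ⟨c, hc⟩ : ∃ c, x k = c * b k := ⟨x k / b k, by field_simp⟩
    -- Moving forward from `k` divides by `ℓₖ₊ₜ₊₁(p)`, which is nonzero until index `k - 1` is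
    -- reached. The coordinate `k - 1` itself is obtained by one step backwards from `k`, dividing
    -- by `ℓₖ₋₂(p)`.
    have step : ∀ t : ℕ, t + 2 ≤ d → x (k + t) = c * b (k + t) := by
      intro t
      induction t with
      | zero => intro _; simpa using hc
      | succ t ih =>
        intro ht
        have hl : edgeValue v (k + t + 1) p ≠ 0 := by
          apply hk
          · intro h
            exact natCast_zmod_ne_zero (d := d) (n := t + 2) (by omega) (by omega)
              (by push_cast; linear_combination h)
          · intro h
            exact natCast_zmod_ne_zero (d := d) (n := t + 1) (by omega) (by omega)
              (by push_cast; linear_combination h)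
        have e1 := hx (k + t)
        have e2 := hbr (k + t)
        rw [ih (by omega)] at e1
        push_cast
        rw [← add_assoc]
        apply mul_right_cancel₀ hl
        apply mul_left_cancel₀ (hv.alpha_ne_zero hd (k + t))
        linear_combination c * e2 - e1
    have hlast : x (k - 1) = c * b (k - 1) := by
      have hl : edgeValue v (k - 1 - 1) p ≠ 0 := by
        apply hk
        · intro h
          exact one_ne (by linear_combination -h)
        · intro h
          exact two_ne (by linear_combination -h)
      have e1 := hx (k - 1)
      have e2 := hbr (k - 1)
      rw [sub_add_cancel] at e1 e2
      rw [hc] at e1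
      apply mul_right_cancel₀ hl
      apply mul_left_cancel₀ (hv.alpha_ne_zero hd k)
      linear_combination e1 - c * e2
    have hxb : x = c • b := by
      funext m
      have hm : k + ((m - k).val : ZMod d) = m := by
        rw [ZMod.natCast_zmod_val]; ring
      by_cases ht : (m - k).val + 2 ≤ d
      · rw [← hm]
        exact step _ ht
      · have hlt := ZMod.val_lt (m - k)
        have h3 : (m - k).val + 1 = d := by omega
        have h4 : ((m - k).val : ZMod d) + 1 = 0 := by
          have := congrArg (Nat.cast : ℕ → ZMod d) h3
          simpa using this
        have : m = k - 1 := by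
          rw [← hm]; linear_combination h4
        rw [this]
        exact hlast
    rw [hxb, ← aeval_eq_eval, aeval_smul_of_isHomogeneous hf,
      aeval_numerator_eq_zero hd v hf h0 p, mul_zero]
  · push Not at hA
    obtain ⟨m, n, hmn, h1, h2, hm, hn⟩ : ∃ m n : ZMod d, m ≠ n ∧ n ≠ m + 1 ∧ m ≠ n + 1 ∧
        edgeValue v m p = 0 ∧ edgeValue v n p = 0 := by
      obtain ⟨i, -, -, hi⟩ := hA 0
      obtain ⟨j, hj1, hj2, hj⟩ := hA i
      by_cases hji : j = i + 1
      · exfalso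
        obtain ⟨k, hk1, hk2, hk⟩ := hA (i + 1)
        rw [add_sub_cancel_right] at hk1
        rw [← hji] at hk2
        exact hv.edgeValue_ne_zero hj2.symm hk1.symm hk2.symm hp hi hj hk
      · exact ⟨i, j, hj2.symm, hji, fun h => hj1 (by rw [h]; ring), hi, hj⟩
    refine eval_eq_zero_of_base_point hd hv hmn h1 h2 hp hm hn ?_ (hx m) (hx n) hf h0
    -- Multiplied by `ℓᵢ(p)`, the relations say that `xᵢ ℓᵢ₋₁(p) ℓᵢ(p) / αᵢ` does not depend on `i`.
    -- It is zero at `i = m`, so `xᵢ = 0` wherever neither edge at the vertex `i` passes through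
    -- `p`.
    have hy : ∀ i, alpha v (i + 1) * (x i * edgeValue v (i - 1) p * edgeValue v i p) =
        alpha v i * (x (i + 1) * edgeValue v i p * edgeValue v (i + 1) p) := fun i => by
      linear_combination edgeValue v i p * hx i
    have hy0 : ∀ t : ℕ, x (m + t) * edgeValue v (m + t - 1) p * edgeValue v (m + t) p = 0 := by
      intro t
      induction t with
      | zero => simp [hm]
      | succ t ih =>
        have := hy (m + t)
        rw [ih, mul_zero, eq_comm] at this
        have h3 := (mul_eq_zero.1 this).resolve_left (hv.alpha_ne_zero hd _)
        push_cast
        rw [← add_assoc, add_sub_cancel_right]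
        exact h3
    intro k k1 k2 k3 k4
    have hk : m + ((k - m).val : ZMod d) = k := by
      rw [ZMod.natCast_zmod_val]; ring
    have h5 := hy0 (k - m).val
    rw [hk] at h5
    have hne : ∀ j, j ≠ m → j ≠ n → edgeValue v j p ≠ 0 := fun j hjm hjn =>
      hv.edgeValue_ne_zero hmn hjm.symm hjn.symm hp hm hn
    have e1 : edgeValue v (k - 1) p ≠ 0 :=
      hne _ (fun h => k2 (by rw [← h]; ring)) (fun h => k4 (by rw [← h]; ring))
    exact (mul_eq_zero.1 ((mul_eq_zero.1 h5).resolve_right (hne k k1 k3))).resolve_right e1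

end Surface

/-! ### Linear and quadratic forms as functions on vectors. -/

theorem exists_linear_of_isHomogeneous_one {σ K : Type*} [Field K] {f : MvPolynomial σ K}
    (hf : f.IsHomogeneous 1) : ∃ φ : (σ → K) →ₗ[K] K, ∀ x, eval x f = φ x := by
  have hf' : f ∈ homogeneousSubmodule σ K 1 := hf
  rw [homogeneousSubmodule_one_eq_span_X] at hf'
  clear hf
  induction hf' using Submodule.span_induction with
  | mem f h =>
    obtain ⟨i, rfl⟩ := h
    exact ⟨LinearMap.proj i, fun x => by simp⟩
  | zero => exact ⟨0, fun x => by simp⟩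
  | add f g hf hg h1 h2 =>
    obtain ⟨φ, hφ⟩ := h1
    obtain ⟨ψ, hψ⟩ := h2
    exact ⟨φ + ψ, fun x => by simp [hφ, hψ]⟩
  | smul c f hf h1 =>
    obtain ⟨φ, hφ⟩ := h1
    exact ⟨c • φ, fun x => by simp [hφ]⟩

/-- `B` need not be symmetric, so nothing is divided by two and characteristic two is included. The
polar form is `B x y + B y x`. -/
theorem exists_bilinear_of_isHomogeneous_two {σ K : Type*} [Field K] {f : MvPolynomial σ K}
    (hf : f.IsHomogeneous 2) :
    ∃ B : (σ → K) →ₗ[K] (σ → K) →ₗ[K] K, ∀ x, eval x f = B x x := by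
  have hf' : f ∈ homogeneousSubmodule σ K 2 := hf
  rw [← homogeneousSubmodule_one_pow, pow_two] at hf'
  refine Submodule.mul_induction_on hf' ?_ ?_
  · intro g hg h hh
    obtain ⟨φ, hφ⟩ := exists_linear_of_isHomogeneous_one hg
    obtain ⟨ψ, hψ⟩ := exists_linear_of_isHomogeneous_one hh
    exact ⟨(LinearMap.mul K K).compl₁₂ φ ψ, fun x => by simp [hφ, hψ]⟩
  · rintro g h ⟨B, hB⟩ ⟨B', hB'⟩
    exact ⟨B + B', fun x => by simp [hB, hB']⟩

/-! ### Quadrics through the surface vanish on the center. -/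

section Center

variable {K : Type*} [Field K] {d : ℕ} {v : ZMod d → Fin 2 → K}

theorem edgeValue_add (v : ZMod d → Fin 2 → K) (j : ZMod d) (p q : Fin 3 → K) :
    edgeValue v j (p + q) = edgeValue v j p + edgeValue v j q := by
  simp [edgeValue]

theorem edgeValue_smul (v : ZMod d → Fin 2 → K) (j : ZMod d) (c : K) (p : Fin 3 → K) :
    edgeValue v j (c • p) = c * edgeValue v j p := by
  simp [edgeValue]

/-- The intersection point of two edge lines. -/
def edgeMeet (v : ZMod d → Fin 2 → K) (m n : ZMod d) : Fin 3 → K :=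
  crossProduct (normal v m) (normal v n)

theorem edgeMeet_eq (v : ZMod d → Fin 2 → K) (m n : ZMod d) :
    edgeMeet v m n =
      edgeValue v n (ray v m) • ray v (m + 1) + (-edgeValue v n (ray v (m + 1))) • ray v m := by
  funext k
  fin_cases k <;>
  simp [edgeMeet, edgeValue, normal, ray, crossProduct, dotProduct, Fin.sum_univ_three] <;> ring

theorem edgeMeet_swap (v : ZMod d → Fin 2 → K) (m n : ZMod d) :
    edgeMeet v m n = (-1 : K) • edgeMeet v n m := by
  rw [edgeMeet, edgeMeet, ← cross_anticomm, neg_one_smul]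

theorem edgeValue_edgeMeet_left (v : ZMod d → Fin 2 → K) (m n : ZMod d) :
    edgeValue v m (edgeMeet v m n) = 0 := dot_self_cross _ _

theorem edgeValue_edgeMeet_right (v : ZMod d → Fin 2 → K) (m n : ZMod d) :
    edgeValue v n (edgeMeet v m n) = 0 := dot_cross_self _ _

theorem edgeValue_sub_one_edgeMeet (v : ZMod d → Fin 2 → K) (m n : ZMod d) :
    edgeValue v (m - 1) (edgeMeet v m n) = edgeValue v n (ray v m) * alpha v m := by
  rw [edgeMeet_eq, edgeValue_add, edgeValue_smul, edgeValue_smul, edgeValue_sub_one_ray_self,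
    edgeValue_sub_one_ray_add_one]
  ring

theorem edgeValue_add_one_edgeMeet (v : ZMod d → Fin 2 → K) (m n : ZMod d) :
    edgeValue v (m + 1) (edgeMeet v m n) =
      -edgeValue v n (ray v (m + 1)) * alpha v (m + 1) := by
  rw [edgeMeet_eq, edgeValue_add, edgeValue_smul, edgeValue_smul, edgeValue_ray_self,
    edgeValue_add_one_ray_self]
  ring

theorem NoThreeConcurrent.edgeMeet_ne_zero (hd : 4 ≤ d) (hv : NoThreeConcurrent v)
    {m n : ZMod d} (hmn : m ≠ n) (h1 : n ≠ m + 1) : edgeMeet v m n ≠ 0 := by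
  intro h
  have hm : m ≠ m + 1 := fun h => natCast_zmod_ne_zero (d := d) (n := 1) (by omega) (by omega)
    (by push_cast; linear_combination -h)
  have hdet := hv.det_ne_zero hm.symm h1.symm hmn
  apply hdet
  have : Matrix.det (Matrix.of ![normal v (m + 1), normal v m, normal v n]) =
      normal v (m + 1) ⬝ᵥ edgeMeet v m n := (triple_product_eq_det _ _ _).symm
  rw [this, h, dotProduct_zero]

variable [NeZero d]

/-- By `edgeMeet_eq`, the coefficients of this vector are, up to sign, those expressing the meet of
the two lines through the ends of either edge. They therefore satisfy the relations of that base
point, which puts a vector of `ker τ` on the surface. -/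
theorem eval_edgeRelation_eq_zero (hd : 4 ≤ d) (hv : NoThreeConcurrent v)
    {m n : ZMod d} (hmn : m ≠ n) (h1 : n ≠ m + 1) (h2 : m ≠ n + 1)
    {f : MvPolynomial (ZMod d) K} {N : ℕ} (hf : f.IsHomogeneous N) (h0 : pullback v f = 0) :
    eval (edgeRelation v m n) f = 0 := by
  have one_ne : (1 : ZMod d) ≠ 0 := by
    simpa using natCast_zmod_ne_zero (d := d) (n := 1) (by omega) (by omega)
  have hm2 : m + 1 ≠ m := fun h => one_ne (by linear_combination h)
  have hn2 : n + 1 ≠ n := fun h => one_ne (by linear_combination h)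
  have h3 : m + 1 ≠ n + 1 := fun h => hmn (add_right_cancel h)
  refine eval_eq_zero_of_base_point hd hv hmn h1 h2 (hv.edgeMeet_ne_zero hd hmn h1)
    (edgeValue_edgeMeet_left v m n) (edgeValue_edgeMeet_right v m n) ?_ ?_ ?_ hf h0
  · intro k k1 k2 k3 k4
    simp [edgeRelation, k1, k2, k3, k4]
  · rw [edgeValue_sub_one_edgeMeet, edgeValue_add_one_edgeMeet]
    simp [edgeRelation, hm2, hm2.symm, hmn, h2, h1.symm, h3]
    ring
  · rw [edgeMeet_swap, edgeValue_smul, edgeValue_smul, edgeValue_sub_one_edgeMeet,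
      edgeValue_add_one_edgeMeet]
    simp [edgeRelation, hn2, hn2.symm, hmn.symm, h2.symm, h1, h3.symm]
    ring

/-- A linear relation among three consecutive rays is trivial. -/
theorem eq_zero_of_tauVec_eq_zero (hd : 4 ≤ d) (hv : NoThreeConcurrent v) {x : ZMod d → K}
    (hx : tauVec v x = 0) (a : ZMod d)
    (hs : ∀ i, i ≠ a → i ≠ a + 1 → i ≠ a + 2 → x i = 0) : x = 0 := by
  have h12 : a + 1 + 1 = a + 2 := by ring
  have h0 : ∀ j, ∑ i, x i * edgeValue v j (ray v i) = 0 := fun j => by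
    rw [← edgeValue_tauVec, hx]; simp [edgeValue]
  have ha : x a = 0 := by
    have := h0 (a + 1)
    rw [Finset.sum_eq_single a, edgeValue_add_one_ray_self] at this
    · exact (mul_eq_zero.1 this).resolve_right (hv.alpha_ne_zero hd _)
    · intro i _ hi
      by_cases i1 : i = a + 1
      · rw [i1, edgeValue_ray_self, mul_zero]
      by_cases i2 : i = a + 2
      · rw [i2, ← h12, edgeValue_ray_add_one, mul_zero]
      rw [hs i hi i1 i2, zero_mul]
    · simp
  have ha2 : x (a + 2) = 0 := by
    have := h0 a
    rw [Finset.sum_eq_single (a + 2)] at this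
    · have e : edgeValue v a (ray v (a + 2)) = alpha v (a + 1) := by
        simpa [h12] using edgeValue_sub_one_ray_add_one v (a + 1)
      rw [e] at this
      exact (mul_eq_zero.1 this).resolve_right (hv.alpha_ne_zero hd _)
    · intro i _ hi
      by_cases i1 : i = a + 1
      · rw [i1, edgeValue_ray_add_one, mul_zero]
      by_cases i2 : i = a
      · rw [i2, ha, zero_mul]
      rw [hs i i2 i1 hi, zero_mul]
    · simp
  have ha1 : x (a + 1) = 0 := by
    have := h0 (a + 2)
    rw [Finset.sum_eq_single (a + 1), ← h12, edgeValue_add_one_ray_self] at this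
    · exact (mul_eq_zero.1 this).resolve_right (hv.alpha_ne_zero hd _)
    · intro i _ hi
      by_cases i2 : i = a + 2
      · rw [i2, ha2, zero_mul]
      by_cases i1 : i = a
      · rw [i1, ha, zero_mul]
      rw [hs i i1 hi i2, zero_mul]
    · simp
  funext i
  by_cases i0 : i = a
  · rw [i0, ha]; rfl
  by_cases i1 : i = a + 1
  · rw [i1, ha1]; rfl
  by_cases i2 : i = a + 2
  · rw [i2, ha2]; rfl
  exact hs i i0 i1 i2

/-- A quadric through the Wachspress surface vanishes on every linear relation among the rays
`a, …, a + l + 2`; the proof is by induction on the length of the interval. -/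
theorem eval_eq_zero_of_support_interval (hd : 4 ≤ d) (hv : NoThreeConcurrent v)
    {f : MvPolynomial (ZMod d) K} (hf : f.IsHomogeneous 2) (h0 : pullback v f = 0) (l : ℕ) :
    ∀ a : ℕ, a + l + 2 < d → ∀ x : ZMod d → K, tauVec v x = 0 →
      (∀ j : ℕ, j < d → (j < a ∨ a + l + 2 < j) → x j = 0) → eval x f = 0 := by
  have cast_inj : ∀ i j : ℕ, i < d → j < d → i ≠ j → (i : ZMod d) ≠ j := fun i j hi hj hij h =>
    hij (by rwa [ZMod.natCast_eq_natCast_iff', Nat.mod_eq_of_lt hi, Nat.mod_eq_of_lt hj] at h)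
  obtain ⟨B, hB⟩ := exists_bilinear_of_isHomogeneous_two hf
  have hsmall : ∀ a : ℕ, a + 2 < d → ∀ x : ZMod d → K, tauVec v x = 0 →
      (∀ j : ℕ, j < d → (j < a ∨ a + 2 < j) → x j = 0) → x = 0 := by
    intro a ha x hx hs
    refine eq_zero_of_tauVec_eq_zero hd hv hx a fun i i0 i1 i2 => ?_
    rw [← ZMod.natCast_zmod_val i]
    refine hs _ (ZMod.val_lt i) ?_
    by_contra! hcon
    have : i.val = a ∨ i.val = a + 1 ∨ i.val = a + 2 := by omega
    rcases this with h | h | h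
    · exact i0 (by rw [← h, ZMod.natCast_zmod_val])
    · exact i1 (by rw [← ZMod.natCast_zmod_val i, h]; push_cast; rfl)
    · exact i2 (by rw [← ZMod.natCast_zmod_val i, h]; push_cast; rfl)
  -- The induction needs both extreme coefficients nonzero. Natural indices below `d` keep the
  -- interval from wrapping around the polygon.
  have hrel : ∀ a b : ℕ, a + 2 ≤ b → b + 1 < d →
      eval (edgeRelation v a b) f = 0 ∧ edgeRelation v a b (a : ℕ) ≠ 0 ∧
      edgeRelation v a b (b + 1 : ℕ) ≠ 0 ∧
      ∀ j : ℕ, j < d → (j < a ∨ b + 1 < j) → edgeRelation v a b j = 0 := by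
    intro a b hab hb
    have e1 : (a : ZMod d) ≠ b := cast_inj _ _ (by omega) (by omega) (by omega)
    have e2 : (b : ZMod d) ≠ a + 1 := by
      exact_mod_cast cast_inj b (a + 1) (by omega) (by omega) (by omega)
    have e3 : (a : ZMod d) ≠ b + 1 := by
      exact_mod_cast cast_inj a (b + 1) (by omega) (by omega) (by omega)
    have e4 : (a : ZMod d) ≠ a + 1 := by
      exact_mod_cast cast_inj a (a + 1) (by omega) (by omega) (by omega)
    have e5 : (b : ZMod d) + 1 ≠ b := by
      exact_mod_cast cast_inj (b + 1) b (by omega) (by omega) (by omega)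
    have e6 : (b : ZMod d) + 1 ≠ a + 1 := fun h => e1 (add_right_cancel h).symm
    refine ⟨eval_edgeRelation_eq_zero hd hv e1 e2 e3 hf h0, ?_, ?_, ?_⟩
    · simp only [edgeRelation, Pi.add_apply, Pi.single_apply, e1, e3, e4, if_true, if_false,
        add_zero]
      refine hv.edgeValue_ray_ne_zero hd ?_ e2
      rw [add_sub_cancel_right]; exact e1.symm
    · simp only [edgeRelation, Pi.add_apply, Pi.single_apply, e3.symm, e5, e6, if_true, if_false,
        zero_add, Nat.cast_add, Nat.cast_one]
      refine neg_ne_zero.2 (hv.edgeValue_ray_ne_zero hd ?_ e1)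
      intro h
      apply e2
      rw [h]; ring
    · intro j hj hj'
      have c1 : (j : ZMod d) ≠ a := cast_inj _ _ hj (by omega) (by omega)
      have c2 : (j : ZMod d) ≠ a + 1 := by
        exact_mod_cast cast_inj j (a + 1) hj (by omega) (by omega)
      have c3 : (j : ZMod d) ≠ b := cast_inj _ _ hj (by omega) (by omega)
      have c4 : (j : ZMod d) ≠ b + 1 := by
        exact_mod_cast cast_inj j (b + 1) hj (by omega) (by omega)
      simp [edgeRelation, c1, c2, c3, c4]
  induction l with
  | zero =>
    intro a ha x hx hs
    rw [hsmall a ha x hx hs, hB]; simp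
  | succ l ih =>
    intro a ha x hx hs
    obtain ⟨k1, k2, k3, k4⟩ := hrel a (a + l + 2) (by omega) (by omega)
    set κ := edgeRelation v a (a + l + 2 : ℕ) with hκ
    have hκτ : tauVec v κ = 0 := tauVec_edgeRelation v _ _
    -- Subtracting from `κ` the multiple of `y` that cancels the coefficient at `a` leaves a
    -- relation on the shorter interval starting at `a + 1`. Since `f` vanishes there, at `y` and at
    -- `κ`, only the polar term survives.
    have polar_ne : ∀ y : ZMod d → K, tauVec v y = 0 →
        (∀ j : ℕ, j < d → (j < a ∨ a + l + 2 < j) → y j = 0) → y a ≠ 0 →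
        B κ y + B y κ = 0 := by
      intro y hy hys hya
      have hz := ih (a + 1) (by omega) (κ + (-(κ a / y a)) • y)
        (by rw [tauVec_add, tauVec_smul, hκτ, hy]; simp) (by
          intro j hj hj'
          by_cases hja : j = a
          · subst hja
            simp only [Pi.add_apply, Pi.smul_apply, smul_eq_mul]
            field_simp
            ring
          · simp only [Pi.add_apply, Pi.smul_apply, smul_eq_mul]
            rw [k4 j hj (by omega), hys j hj (by omega)]; ring)
      have hy0 := ih a (by omega) y hy hys
      rw [hB] at hz hy0 k1
      simp only [map_add, map_smul, LinearMap.add_apply, LinearMap.smul_apply, smul_eq_mul] at hz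
      have hc : κ a / y a ≠ 0 := div_ne_zero k2 hya
      apply mul_left_cancel₀ hc
      linear_combination k1 - hz + (κ a / y a) ^ 2 * hy0
    have polar : ∀ y : ZMod d → K, tauVec v y = 0 →
        (∀ j : ℕ, j < d → (j < a ∨ a + l + 2 < j) → y j = 0) → B κ y + B y κ = 0 := by
      intro y hy hys
      by_cases hya : y a = 0
      · rcases Nat.eq_zero_or_pos l with rfl | hl
        · rw [hsmall a (by omega) y hy hys]; simp
        · obtain ⟨-, c2, -, c4⟩ := hrel a (a + 2) (by omega) (by omega)
          have s1 : ∀ j : ℕ, j < d → (j < a ∨ a + l + 2 < j) →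
              edgeRelation v a (a + 2 : ℕ) j = 0 := fun j hj hj' => c4 j hj (by omega)
          have p1 := polar_ne _ (tauVec_edgeRelation v _ _) s1 c2
          have p2 := polar_ne (y + edgeRelation v a (a + 2 : ℕ))
            (by rw [tauVec_add, hy, tauVec_edgeRelation, add_zero])
            (fun j hj hj' => by rw [Pi.add_apply, hys j hj hj', s1 j hj hj', add_zero])
            (by rwa [Pi.add_apply, hya, zero_add])
          simp only [map_add, LinearMap.add_apply] at p2
          linear_combination p2 - p1
      · exact polar_ne y hy hys hya
    -- Removing the last coefficient of `x` with `κ` leaves `y` on a shorter interval, and `f(x) =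
    -- f(y) + c · polar(κ, y) + c² f(κ)`.
    set c := x (a + l + 2 + 1 : ℕ) / κ (a + l + 2 + 1 : ℕ) with hc
    set y := x + (-c) • κ with hy
    have hyτ : tauVec v y = 0 := by rw [hy, tauVec_add, tauVec_smul, hκτ, hx]; simp
    have hys : ∀ j : ℕ, j < d → (j < a ∨ a + l + 2 < j) → y j = 0 := by
      intro j hj hj'
      by_cases hja : j = a + l + 2 + 1
      · rw [hja, hy]
        simp only [Pi.add_apply, Pi.smul_apply, smul_eq_mul, hc]
        field_simp
        ring
      · simp only [hy, Pi.add_apply, Pi.smul_apply, smul_eq_mul]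
        rw [k4 j hj (by omega), hs j hj (by omega)]; ring
    have e1 := polar y hyτ hys
    have e2 := ih a (by omega) y hyτ hys
    have hxy : x = y + c • κ := by rw [hy]; module
    rw [hB] at e2 k1 ⊢
    rw [hxy]
    simp only [map_add, map_smul, LinearMap.add_apply, LinearMap.smul_apply, smul_eq_mul]
    linear_combination e2 + c * e1 + c ^ 2 * k1

theorem eval_quadric_eq_zero (hd : 4 ≤ d) (hv : NoThreeConcurrent v)
    {f : MvPolynomial (ZMod d) K} (hf : f.IsHomogeneous 2) (h0 : pullback v f = 0)
    {x : ZMod d → K} (hx : tauVec v x = 0) : eval x f = 0 :=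
  eval_eq_zero_of_support_interval hd hv hf h0 (d - 3) 0 (by omega) x hx
    fun j hj hj' => by omega

end Center

/-! ### Linear precision, the explicit quadrics and the cubics. -/

section LinearPrecision

variable {K : Type*} [Field K] {d : ℕ} {R : Type*} [CommRing R] [Algebra K R]

theorem aeval_edgeForm (v : ZMod d → Fin 2 → K) (j : ZMod d) (q : Fin 3 → R) :
    aeval q (edgeForm v j) = ∑ k, algebraMap K R (normal v j k) * q k := by
  simp [edgeForm]

/-- Since `αᵢ (vᵢ, 1) = nᵢ₋₁ × nᵢ`, this is the expansion of the triple cross product `(nᵢ₋₁ × nᵢ) ×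
q`. -/
theorem algebraMap_alpha_smul_cross (v : ZMod d → Fin 2 → K) (i : ZMod d) (q : Fin 3 → R) :
    algebraMap K R (alpha v i) • crossProduct (fun k => algebraMap K R (ray v i k)) q =
      aeval q (edgeForm v (i - 1)) • (fun k => algebraMap K R (normal v i k)) -
        aeval q (edgeForm v i) • (fun k => algebraMap K R (normal v (i - 1) k)) := by
  have h : normal v (i - 1) = crossProduct (ray v (i - 1)) (ray v i) := by
    simp [normal]
  rw [aeval_edgeForm, aeval_edgeForm, h]
  funext k
  fin_cases k <;>
  simp [normal, ray, alpha, crossProduct, Fin.sum_univ_three, Matrix.det_fin_three] <;> ring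

/-- The row of coefficients of the relation `αᵢ₊₁ xᵢ ℓᵢ₋₁ = αᵢ xᵢ₊₁ ℓᵢ₊₁`. -/
noncomputable def relationRow (v : ZMod d → Fin 2 → K) (i : ZMod d) (k : Fin 3) :
    MvPolynomial (ZMod d) K :=
  C (alpha v (i + 1) * normal v (i - 1) k) * X i - C (alpha v i * normal v (i + 1) k) * X (i + 1)

/-- The Wachspress cubic: a maximal minor of the matrix of all relations. -/
noncomputable def cubicForm (v : ZMod d → Fin 2 → K) (i : Fin 3 → ZMod d) :
    MvPolynomial (ZMod d) K :=
  Matrix.det (Matrix.of fun a k => relationRow v (i a) k)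

theorem isHomogeneous_cubicForm (v : ZMod d → Fin 2 → K) (i : Fin 3 → ZMod d) :
    (cubicForm v i).IsHomogeneous 3 := by
  have h : ∀ i k, (relationRow v i k).IsHomogeneous 1 := fun i k =>
    (isHomogeneous_C_mul_X _ _).sub (isHomogeneous_C_mul_X _ _)
  rw [cubicForm, Matrix.det_fin_three]
  simp only [Matrix.of_apply]
  have h3 : ∀ a b c : MvPolynomial (ZMod d) K, a.IsHomogeneous 1 → b.IsHomogeneous 1 →
    c.IsHomogeneous 1 → (a * b * c).IsHomogeneous 3 := fun a b c ha hb hc => (ha.mul hb).mul hc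
  refine IsHomogeneous.sub (IsHomogeneous.add (IsHomogeneous.add (IsHomogeneous.sub
    (IsHomogeneous.sub ?_ ?_) ?_) ?_) ?_) ?_ <;>
  exact h3 _ _ _ (h _ _) (h _ _) (h _ _)

theorem exists_relation_of_eval_cubicForm (v : ZMod d → Fin 2 → K) (i : Fin 3 → ZMod d)
    {x : ZMod d → K} (h : eval x (cubicForm v i) = 0) :
    ∃ p : Fin 3 → K, p ≠ 0 ∧ ∀ a, alpha v (i a + 1) * x (i a) * edgeValue v (i a - 1) p =
      alpha v (i a) * x (i a + 1) * edgeValue v (i a + 1) p := by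
  rw [cubicForm, RingHom.map_det] at h
  obtain ⟨p, hp, hp0⟩ := Matrix.exists_mulVec_eq_zero_iff.2 h
  refine ⟨p, hp, fun a => ?_⟩
  have := congrFun hp0 a
  simp [Matrix.mulVec, dotProduct, Fin.sum_univ_three, relationRow] at this
  simp only [edgeValue, dotProduct, Fin.sum_univ_three]
  linear_combination this

variable [NeZero d]

/-- Linear precision: `∑ᵢ bᵢ(q) (vᵢ, 1)` is proportional to `q`. -/
theorem sum_numerator_smul_cross (hd : 4 ≤ d) (v : ZMod d → Fin 2 → K) (q : Fin 3 → R) :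
    ∑ i, aeval q (numerator v i) • crossProduct (fun k => algebraMap K R (ray v i k)) q = 0 := by
  -- With this `G` each summand is `G i - G (i - 1)`, and the sum telescopes around the cycle.
  set G : ZMod d → Fin 3 → R := fun i => (∏ j ∈ Finset.univ.erase i, aeval q (edgeForm v j)) •
    fun k => algebraMap K R (normal v i k) with hG
  have h : ∀ i, aeval q (numerator v i) • crossProduct (fun k => algebraMap K R (ray v i k)) q =
      G i - G (i - 1) := by
    intro i
    rw [aeval_numerator, mul_comm, mul_smul, algebraMap_alpha_smul_cross, hG]
    simp only
    rw [prod_erase_eq_mul_sub_one hd, prod_erase_sub_one_eq_mul hd, mul_smul, mul_smul, smul_sub]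
  rw [Finset.sum_congr rfl fun i _ => h i, Finset.sum_sub_distrib, sub_eq_zero]
  exact (Equiv.sum_comp (Equiv.subRight (1 : ZMod d)) G).symm

theorem pullback_X (v : ZMod d → Fin 2 → K) (i : ZMod d) :
    pullback v (X i) = affineNumerator v i := by
  simp [pullback]

theorem pullback_tau (hd : 4 ≤ d) (v : ZMod d → Fin 2 → K) (k : Fin 3) :
    pullback v (tau v k) =
      pullback v (tau v 2) * (![X 0, X 1, 1] : Fin 3 → MvPolynomial (Fin 2) K) k := by
  set q : Fin 3 → MvPolynomial (Fin 2) K := ![X 0, X 1, 1] with hq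
  have hT : ∀ k, pullback v (tau v k) =
      ∑ i, aeval q (numerator v i) * algebraMap K (MvPolynomial (Fin 2) K) (ray v i k) := by
    intro k
    simp [tau, pullback, affineNumerator, hq, mul_comm, algebraMap_eq]
  have h := sum_numerator_smul_cross hd v q
  have h0 := congrFun h 0
  have h1 := congrFun h 1
  simp only [crossProduct, LinearMap.mk₂_apply, Finset.sum_apply, Pi.smul_apply, smul_eq_mul,
    Matrix.cons_val, mul_sub, Finset.sum_sub_distrib, ← mul_assoc, ← Finset.sum_mul, ← hT,
    Pi.zero_apply] at h0 h1
  fin_cases k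
  · simp [hq] at h1 ⊢
    linear_combination -h1
  · simp [hq] at h0 ⊢
    linear_combination h0
  · simp [hq]

/-- The linear form `ℓⱼ ∘ τ`. -/
noncomputable def edgeTau (v : ZMod d → Fin 2 → K) (j : ZMod d) : MvPolynomial (ZMod d) K :=
  ∑ k, C (normal v j k) * tau v k

theorem isHomogeneous_tau (v : ZMod d → Fin 2 → K) (k : Fin 3) : (tau v k).IsHomogeneous 1 :=
  IsHomogeneous.sum _ _ _ fun _ _ => isHomogeneous_C_mul_X _ _

theorem isHomogeneous_edgeTau (v : ZMod d → Fin 2 → K) (j : ZMod d) :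
    (edgeTau v j).IsHomogeneous 1 :=
  IsHomogeneous.sum _ _ _ fun k _ => (isHomogeneous_tau v k).C_mul _

theorem eval_edgeTau (v : ZMod d → Fin 2 → K) (j : ZMod d) (x : ZMod d → K) :
    eval x (edgeTau v j) = edgeValue v j (tauVec v x) := by
  simp [edgeTau, edgeValue, eval_tau, dotProduct]

theorem pullback_edgeTau (hd : 4 ≤ d) (v : ZMod d → Fin 2 → K) (j : ZMod d) :
    pullback v (edgeTau v j) = pullback v (tau v 2) * aeval ![X 0, X 1, 1] (edgeForm v j) := by
  rw [edgeTau, map_sum, aeval_edgeForm, Finset.mul_sum]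
  refine Finset.sum_congr rfl fun k _ => ?_
  rw [map_mul, pullback_tau hd v k, ← algebraMap_eq, AlgHom.commutes]
  ring

/-- The Wachspress quadric `αᵢ₊₁ xᵢ ℓᵢ₋₁(τ) - αᵢ xᵢ₊₁ ℓᵢ₊₁(τ)`. -/
noncomputable def quadricForm (v : ZMod d → Fin 2 → K) (i : ZMod d) : MvPolynomial (ZMod d) K :=
  C (alpha v (i + 1)) * X i * edgeTau v (i - 1) - C (alpha v i) * X (i + 1) * edgeTau v (i + 1)

theorem isHomogeneous_quadricForm (v : ZMod d → Fin 2 → K) (i : ZMod d) :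
    (quadricForm v i).IsHomogeneous 2 :=
  ((isHomogeneous_C_mul_X _ _).mul (isHomogeneous_edgeTau v _)).sub
    ((isHomogeneous_C_mul_X _ _).mul (isHomogeneous_edgeTau v _))

theorem eval_quadricForm (v : ZMod d → Fin 2 → K) (i : ZMod d) (x : ZMod d → K) :
    eval x (quadricForm v i) =
      alpha v (i + 1) * x i * edgeValue v (i - 1) (tauVec v x) -
        alpha v i * x (i + 1) * edgeValue v (i + 1) (tauVec v x) := by
  simp [quadricForm, eval_edgeTau]

theorem pullback_quadricForm (hd : 4 ≤ d) (v : ZMod d → Fin 2 → K) (i : ZMod d) :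
    pullback v (quadricForm v i) = 0 := by
  have h := aeval_numerator_relation hd v (![X 0, X 1, 1] : Fin 3 → MvPolynomial (Fin 2) K) i
  rw [quadricForm]
  simp only [map_sub, map_mul, pullback_edgeTau hd, pullback_X, affineNumerator,
    ← algebraMap_eq, AlgHom.commutes]
  linear_combination pullback v (tau v 2) * h

/-- On the image, `(x, y, 1)` is a nonzero kernel vector of the matrix of relations. -/
theorem pullback_cubicForm (hd : 4 ≤ d) (v : ZMod d → Fin 2 → K) (i : Fin 3 → ZMod d) :
    pullback v (cubicForm v i) = 0 := by
  rw [cubicForm, AlgHom.map_det]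
  refine Matrix.exists_mulVec_eq_zero_iff.1 ⟨![X 0, X 1, 1], fun h => ?_, ?_⟩
  · exact one_ne_zero (congrFun h 2)
  funext a
  have h := aeval_numerator_relation hd v (![X 0, X 1, 1] : Fin 3 → MvPolynomial (Fin 2) K) (i a)
  rw [aeval_edgeForm, aeval_edgeForm] at h
  simp [Matrix.mulVec, dotProduct, Fin.sum_univ_three, relationRow, pullback_X, affineNumerator,
    algebraMap_eq] at h ⊢
  simp only [← algebraMap_eq] at h ⊢
  linear_combination h

/-- A linear relation among the rays `a`, `b`, `b + 1`, `b + 2`. -/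
noncomputable def rayRelation (v : ZMod d → Fin 2 → K) (a b : ZMod d) : ZMod d → K :=
  Pi.single a (edgeValue v (b + 1) (ray v b)) + Pi.single b (-edgeValue v (b + 1) (ray v a)) +
    (Pi.single (b + 1) (Matrix.det (Matrix.of ![ray v a, ray v b, ray v (b + 1 + 1)])) +
      Pi.single (b + 1 + 1) (-edgeValue v b (ray v a)))

theorem tauVec_rayRelation (v : ZMod d → Fin 2 → K) (a b : ZMod d) :
    tauVec v (rayRelation v a b) = 0 := by
  simp only [rayRelation, tauVec_add, tauVec_single]
  funext k
  fin_cases k <;>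
  simp [edgeValue, normal, ray, crossProduct, dotProduct, Fin.sum_univ_three,
    Matrix.det_fin_three] <;> ring

/-- The test vector is a relation among the rays `0, 2, 3, 4`, so its coordinates at `1` and `5`
vanish. If the minor of rows `0, 1, 4` vanished there, its kernel vector `p` would lie on the lines
`-1`, `2` and `3`, which are not concurrent. The bound `d ≥ 6` keeps the index `5` apart from `0`.
-/
theorem exists_cubic_eval_ne_zero (hd : 6 ≤ d) {v : ZMod d → Fin 2 → K}
    (hv : NoThreeConcurrent v) :
    ∃ (x : ZMod d → K) (f : MvPolynomial (ZMod d) K),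
      tauVec v x = 0 ∧ f.IsHomogeneous 3 ∧ pullback v f = 0 ∧ eval x f ≠ 0 := by
  have n1 : (1 : ZMod d) ≠ 0 := by
    simpa using natCast_zmod_ne_zero (d := d) (n := 1) (by omega) (by omega)
  have n2 : (2 : ZMod d) ≠ 0 := by
    simpa using natCast_zmod_ne_zero (d := d) (n := 2) (by omega) (by omega)
  have n3 : (3 : ZMod d) ≠ 0 := by
    simpa using natCast_zmod_ne_zero (d := d) (n := 3) (by omega) (by omega)
  have n4 : (4 : ZMod d) ≠ 0 := by
    simpa using natCast_zmod_ne_zero (d := d) (n := 4) (by omega) (by omega)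
  have n5 : (5 : ZMod d) ≠ 0 := by
    simpa using natCast_zmod_ne_zero (d := d) (n := 5) (by omega) (by omega)
  have hd4 : 4 ≤ d := by omega
  refine ⟨rayRelation v 0 2, cubicForm v ![0, 1, 4], tauVec_rayRelation v 0 2,
    isHomogeneous_cubicForm v _, pullback_cubicForm hd4 v _, fun h => ?_⟩
  obtain ⟨p, hp, hr⟩ := exists_relation_of_eval_cubicForm v _ h
  have ne : ∀ a b c : ZMod d, c ≠ 0 → a - b = c → a ≠ b := fun a b c hc h hab =>
    hc (by rw [← h, hab, sub_self])
  have a21 : (2 : ZMod d) + 1 = 3 := by norm_num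
  have a31 : (3 : ZMod d) + 1 = 4 := by norm_num
  have x0 : rayRelation v 0 2 0 ≠ 0 := by
    simp [rayRelation, n2.symm, a21, a31, n3.symm, n4.symm]
    rw [← a21, edgeValue_add_one_ray_self]
    exact hv.alpha_ne_zero hd4 _
  have x1 : rayRelation v 0 2 1 = 0 := by
    simp [rayRelation, a21, a31, n1, (ne 2 1 1 n1 (by norm_num)).symm,
      (ne 3 1 2 n2 (by norm_num)).symm, (ne 4 1 3 n3 (by norm_num)).symm]
  have x2 : rayRelation v 0 2 2 ≠ 0 := by
    simp [rayRelation, a21, a31, n2, (ne 3 2 1 n1 (by norm_num)).symm,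
      (ne 4 2 2 n2 (by norm_num)).symm]
    refine hv.edgeValue_ray_ne_zero hd4 ?_ n3
    exact ne _ _ 4 n4 (by norm_num)
  have x4 : rayRelation v 0 2 4 ≠ 0 := by
    simp [rayRelation, a21, a31, n4, (ne 4 2 2 n2 (by norm_num)),
      (ne 4 3 1 n1 (by norm_num))]
    refine hv.edgeValue_ray_ne_zero hd4 ?_ n2
    exact ne _ _ 3 n3 (by norm_num)
  have x5 : rayRelation v 0 2 5 = 0 := by
    simp [rayRelation, a21, a31, n5, (ne 5 2 3 n3 (by norm_num)),
      (ne 5 3 2 n2 (by norm_num)), (ne 5 4 1 n1 (by norm_num))]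
  have h0 := hr 0
  have h1 := hr 1
  have h2 := hr 2
  have e1 : (1 : ZMod d) + 1 = 2 := by norm_num
  have e4 : (4 : ZMod d) + 1 = 5 := by norm_num
  have e3 : (4 : ZMod d) - 1 = 3 := by norm_num
  simp only [Matrix.cons_val, zero_add, zero_sub, sub_self, e1, e4, e3, x1, x5, mul_zero,
    zero_mul] at h0 h1 h2
  have y0 := (mul_eq_zero.1 h0).resolve_left (mul_ne_zero (hv.alpha_ne_zero hd4 _) x0)
  have y1 := (mul_eq_zero.1 h1.symm).resolve_left (mul_ne_zero (hv.alpha_ne_zero hd4 _) x2)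
  have y2 := (mul_eq_zero.1 h2).resolve_left (mul_ne_zero (hv.alpha_ne_zero hd4 _) x4)
  exact hv.edgeValue_ne_zero (ne 2 3 (-1) (neg_ne_zero.2 n1) (by norm_num))
    (ne 2 (-1) 3 n3 (by norm_num)) (ne 3 (-1) 4 n4 (by norm_num)) hp y1 y2 y0

end LinearPrecision

/-! ### Extension of the ground field. -/

section BaseChange

variable {K : Type*} [Field K] {d : ℕ} (L : Type*) [Field L] [Algebra K L]

/-- The polygon over an extension field. -/
def baseChange (v : ZMod d → Fin 2 → K) : ZMod d → Fin 2 → L :=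
  fun i k => algebraMap K L (v i k)

theorem ray_baseChange (v : ZMod d → Fin 2 → K) (i : ZMod d) (k : Fin 3) :
    ray (baseChange L v) i k = algebraMap K L (ray v i k) := by
  fin_cases k <;> simp [ray, baseChange]

theorem normal_baseChange (v : ZMod d → Fin 2 → K) (i : ZMod d) (k : Fin 3) :
    normal (baseChange L v) i k = algebraMap K L (normal v i k) := by
  fin_cases k <;> simp [normal, crossProduct, ray_baseChange]

theorem alpha_baseChange (v : ZMod d → Fin 2 → K) (i : ZMod d) :
    alpha (baseChange L v) i = algebraMap K L (alpha v i) := by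
  simp [alpha, Matrix.det_fin_three, ray_baseChange]

theorem map_edgeForm (v : ZMod d → Fin 2 → K) (j : ZMod d) :
    map (algebraMap K L) (edgeForm v j) = edgeForm (baseChange L v) j := by
  simp [edgeForm, normal_baseChange]

/-- The condition is the nonvanishing of determinants with entries in `K`, so no concurrency appears
over `L`. -/
theorem NoThreeConcurrent.baseChange {v : ZMod d → Fin 2 → K} (hv : NoThreeConcurrent v) :
    NoThreeConcurrent (baseChange L v) := by
  refine noThreeConcurrent_of_det_ne_zero fun i j k hij hik hjk h => ?_
  refine hv.det_ne_zero hij hik hjk ((algebraMap K L).injective ?_)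
  rw [map_zero, ← h, RingHom.map_det]
  congr 1
  ext a b
  fin_cases a <;> simp [normal_baseChange]

variable [NeZero d]

theorem map_numerator (v : ZMod d → Fin 2 → K) (j : ZMod d) :
    map (algebraMap K L) (numerator v j) = numerator (baseChange L v) j := by
  simp [numerator, map_edgeForm, alpha_baseChange]

theorem map_affineNumerator (v : ZMod d → Fin 2 → K) (j : ZMod d) :
    map (algebraMap K L) (affineNumerator v j) = affineNumerator (baseChange L v) j := by
  rw [affineNumerator, affineNumerator, ← map_numerator, map_aeval, aeval_def, eval₂_map,
    coe_eval₂Hom]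
  congr 1
  · ext; simp [algebraMap_eq]
  · funext i; fin_cases i <;> simp

theorem map_pullback (v : ZMod d → Fin 2 → K) (f : MvPolynomial (ZMod d) K) :
    map (algebraMap K L) (pullback v f) =
      pullback (baseChange L v) (map (algebraMap K L) f) := by
  rw [pullback, pullback, map_aeval, aeval_def, eval₂_map, coe_eval₂Hom]
  congr 1
  · ext; simp [algebraMap_eq]
  · funext i; exact map_affineNumerator L v i

theorem map_tau (v : ZMod d → Fin 2 → K) (k : Fin 3) :
    map (algebraMap K L) (tau v k) = tau (baseChange L v) k := by
  simp [tau, ray_baseChange]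

theorem map_edgeTau (v : ZMod d → Fin 2 → K) (j : ZMod d) :
    map (algebraMap K L) (edgeTau v j) = edgeTau (baseChange L v) j := by
  simp [edgeTau, map_tau, normal_baseChange]

theorem map_quadricForm (v : ZMod d → Fin 2 → K) (i : ZMod d) :
    map (algebraMap K L) (quadricForm v i) = quadricForm (baseChange L v) i := by
  simp [quadricForm, map_edgeTau, alpha_baseChange]

end BaseChange

/-! ### Points of `Proj` as field-valued vectors and as kernels. -/

section Points

variable {K : Type*} [Field K] {d : ℕ}

/-- Every point of projective space is the kernel of evaluation at a vector over its residue
domain's field of fractions. -/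
theorem exists_field_point.{u} {K : Type u} [Field K] {d : ℕ} (p : ProjSpace K d) :
    ∃ (L : Type u) (_ : Field L) (_ : Algebra K L) (x : ZMod d → L),
      ∀ f : MvPolynomial (ZMod d) K,
        f ∈ p.asHomogeneousIdeal ↔ eval x (map (algebraMap K L) f) = 0 := by
  let A := MvPolynomial (ZMod d) K ⧸ p.asHomogeneousIdeal.toIdeal
  refine ⟨FractionRing A, inferInstance, inferInstance,
    fun i => algebraMap A _ (Ideal.Quotient.mk _ (X i)), fun f => ?_⟩
  have h : eval (fun i => algebraMap A (FractionRing A) (Ideal.Quotient.mk _ (X i)))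
      (map (algebraMap K (FractionRing A)) f) =
      algebraMap A (FractionRing A) (Ideal.Quotient.mk _ f) := by
    rw [eval_map]
    have : eval₂Hom (algebraMap K (FractionRing A))
        (fun i => algebraMap A (FractionRing A) (Ideal.Quotient.mk _ (X i))) =
        (algebraMap A (FractionRing A)).comp (Ideal.Quotient.mk _) := by
      refine ringHom_ext (fun r => ?_) fun i => ?_
      · simp only [coe_eval₂Hom, eval₂_C, RingHom.comp_apply]
        rw [IsScalarTower.algebraMap_apply K A (FractionRing A)]
        rfl
      · simp
    exact congrArg (fun g : MvPolynomial (ZMod d) K →+* FractionRing A => g f) this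
  rw [h, map_eq_zero_iff _ (IsFractionRing.injective A (FractionRing A)),
    Ideal.Quotient.eq_zero_iff_mem]
  rfl

/-- The point of projective space at which exactly the homogeneous `f` with `φ f = 0` vanish. -/
noncomputable def kernelPoint {R : Type*} [CommRing R] [IsDomain R] [Algebra K R]
    (φ : MvPolynomial (ZMod d) K →ₐ[K] R) (h : ∃ i, φ (X i) ≠ 0) : ProjSpace K d where
  asHomogeneousIdeal := (RingHom.ker φ).homogeneousCore (homogeneousSubmodule (ZMod d) K)
  isPrime := (RingHom.ker_isPrime φ).homogeneousCore
  not_irrelevant_le := by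
    obtain ⟨i, hi⟩ := h
    intro h
    have hX : (X i : MvPolynomial (ZMod d) K) ∈
        HomogeneousIdeal.irrelevant (homogeneousSubmodule (ZMod d) K) := by
      rw [HomogeneousIdeal.mem_irrelevant_iff, GradedRing.proj_apply,
        DirectSum.decompose_of_mem_ne _ (isHomogeneous_X K i) one_ne_zero]
    exact hi (Ideal.toIdeal_homogeneousCore_le _ _ (h hX))

variable {R : Type*} [CommRing R] [IsDomain R] [Algebra K R]
  {φ : MvPolynomial (ZMod d) K →ₐ[K] R} {h : ∃ i, φ (X i) ≠ 0}

theorem apply_eq_zero_of_mem_kernelPoint {f : MvPolynomial (ZMod d) K}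
    (hf : f ∈ (kernelPoint φ h).asHomogeneousIdeal) : φ f = 0 :=
  Ideal.toIdeal_homogeneousCore_le _ _ hf

theorem mem_kernelPoint_iff {f : MvPolynomial (ZMod d) K} {n : ℕ} (hf : f.IsHomogeneous n) :
    f ∈ (kernelPoint φ h).asHomogeneousIdeal ↔ φ f = 0 :=
  ⟨apply_eq_zero_of_mem_kernelPoint,
    fun h0 => Ideal.mem_homogeneousCore_of_homogeneous_of_mem ⟨n, hf⟩ h0⟩

theorem mem_closure_kernelPoint_iff {p : ProjSpace K d} :
    p ∈ closure {kernelPoint φ h} ↔ ∀ (n : ℕ) (f : MvPolynomial (ZMod d) K),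
      f.IsHomogeneous n → φ f = 0 → f ∈ p.asHomogeneousIdeal := by
  rw [← ProjectiveSpectrum.le_iff_mem_closure, ← ProjectiveSpectrum.as_ideal_le_as_ideal]
  constructor
  · intro hle n f hf h0
    exact hle ((mem_kernelPoint_iff hf).2 h0)
  · intro hp
    change (Ideal.homogeneousCore' _ _) ≤ p.asHomogeneousIdeal.toIdeal
    refine Ideal.span_le.2 ?_
    rintro _ ⟨⟨f, n, hf⟩, h0, rfl⟩
    exact hp n f hf h0

end Points

/-! ### Irreducible components of a union of two point closures. -/

section Topology

/-- If a space is the union of the closures of two points, neither of which lies in the closure of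
the other, then these closures are its irreducible components. -/
theorem irreducibleComponents_image_eq_pair {X : Type*} [TopologicalSpace X] {Y : Set X} {a b : X}
    (hY : Y = closure {a} ∪ closure {b}) (hab : ¬ closure {a} ⊆ closure {b})
    (hba : ¬ closure {b} ⊆ closure {a}) :
    (fun Z : Set Y => Subtype.val '' Z) '' irreducibleComponents Y = {closure {a}, closure {b}} := by
  have ha : a ∈ Y := hY ▸ Or.inl (subset_closure rfl)
  have hb : b ∈ Y := hY ▸ Or.inr (subset_closure rfl)
  have himg : ∀ (c : X) (hc : c ∈ Y), closure {c} ⊆ Y →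
      (Subtype.val '' closure {(⟨c, hc⟩ : Y)}) = closure {c} := by
    intro c hc hcY
    have h := Topology.IsInducing.subtypeVal.closure_eq_preimage_closure_image {(⟨c, hc⟩ : Y)}
    rw [h, Set.image_singleton, Subtype.image_preimage_coe, Set.inter_eq_right.2 hcY]
  have hA := himg a ha (hY ▸ Set.subset_union_left)
  have hB := himg b hb (hY ▸ Set.subset_union_right)
  have hsub : ∀ Z : Set Y, IsIrreducible Z →
      Z ⊆ closure {⟨a, ha⟩} ∨ Z ⊆ closure {⟨b, hb⟩} := by
    intro Z hZ
    refine isPreirreducible_iff_isClosed_union_isClosed.1 hZ.2 _ _ isClosed_closure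
      isClosed_closure ?_
    rintro ⟨y, hy⟩ -
    have hy' := hy
    rw [hY, ← hA, ← hB] at hy'
    rcases hy' with ⟨z, hz, hzy⟩ | ⟨z, hz, hzy⟩
    · left; rwa [show (⟨y, hy⟩ : Y) = z from Subtype.ext hzy.symm]
    · right; rwa [show (⟨y, hy⟩ : Y) = z from Subtype.ext hzy.symm]
  have irr : ∀ c : Y, IsIrreducible (closure {c}) := fun c => isIrreducible_singleton.closure
  have memA : closure {⟨a, ha⟩} ∈ irreducibleComponents Y := by
    refine ⟨irr _, fun Z hZ hle => ?_⟩
    rcases hsub Z hZ with h | h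
    · exact h
    · refine absurd ?_ hab
      rw [← hA, ← hB]
      exact Set.image_mono (hle.trans h)
  have memB : closure {⟨b, hb⟩} ∈ irreducibleComponents Y := by
    refine ⟨irr _, fun Z hZ hle => ?_⟩
    rcases hsub Z hZ with h | h
    · refine absurd ?_ hba
      rw [← hA, ← hB]
      exact Set.image_mono (hle.trans h)
    · exact h
  ext W
  simp only [Set.mem_image, Set.mem_insert_iff, Set.mem_singleton_iff]
  constructor
  · rintro ⟨Z, hZ, rfl⟩
    rcases hsub Z hZ.1 with h | h
    · left
      rw [← hA, Set.Subset.antisymm h (hZ.2 (irr _) h)]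
    · right
      rw [← hB, Set.Subset.antisymm h (hZ.2 (irr _) h)]
  · rintro (rfl | rfl)
    exacts [⟨_, memA, hA⟩, ⟨_, memB, hB⟩]

end Topology

/-! ### Generic points of the surface and the center, and the inclusions. -/

section Main

variable {K : Type*} [Field K] {d : ℕ} [NeZero d] {v : ZMod d → Fin 2 → K}

theorem eval_numerator_ray_ne_zero (hd : 4 ≤ d) (hv : NoThreeConcurrent v) (i : ZMod d) :
    eval (ray v i) (numerator v i) ≠ 0 := by
  rw [← aeval_eq_eval, aeval_numerator]
  refine mul_ne_zero (hv.alpha_ne_zero hd i) (Finset.prod_ne_zero_iff.2 fun j hj => ?_)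
  simp at hj
  rw [aeval_eq_eval, eval_edgeForm]
  exact hv.edgeValue_ray_ne_zero hd hj.1 hj.2

theorem eval_numerator_ray_of_ne (hd : 4 ≤ d) (v : ZMod d → Fin 2 → K) {i j : ZMod d}
    (hij : j ≠ i) : eval (ray v i) (numerator v j) = 0 := by
  rw [← aeval_eq_eval, aeval_numerator]
  have two_ne : (2 : ZMod d) ≠ 0 := by
    simpa using natCast_zmod_ne_zero (d := d) (n := 2) (by omega) (by omega)
  by_cases h : i = j - 1
  · rw [Finset.prod_eq_zero (i := i - 1), mul_zero]
    · simp only [Finset.mem_sdiff, Finset.mem_univ, Finset.mem_insert, Finset.mem_singleton,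
        true_and, not_or]
      refine ⟨fun h' => hij (by linear_combination -h'), fun h' => two_ne ?_⟩
      linear_combination h - h'
    · rw [aeval_eq_eval, eval_edgeForm, edgeValue_sub_one_ray_self]
  · rw [Finset.prod_eq_zero (i := i), mul_zero]
    · simp [h, hij.symm]
    · rw [aeval_eq_eval, eval_edgeForm, edgeValue_ray_self]

theorem eval_affineNumerator (v : ZMod d → Fin 2 → K) (i j : ZMod d) :
    eval (v i) (affineNumerator v j) = eval (ray v i) (numerator v j) := by
  rw [affineNumerator, ← aeval_eq_eval, ← aeval_eq_eval, ← AlgHom.comp_apply, comp_aeval]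
  congr 2
  funext k
  fin_cases k <;> simp [ray]

theorem exists_pullback_X_ne_zero (hd : 4 ≤ d) (hv : NoThreeConcurrent v) :
    ∃ i, pullback v (X i) ≠ 0 := by
  refine ⟨0, fun h => eval_numerator_ray_ne_zero hd hv 0 ?_⟩
  rw [← eval_affineNumerator, ← pullback_X, h, map_zero]

/-- At the vertex `v 0` only `b₀` is nonzero, so the last component of `τ(b)` there is `b₀(v₀) ≠ 0`.
-/
theorem pullback_tau_two_ne_zero (hd : 4 ≤ d) (hv : NoThreeConcurrent v) :
    pullback v (tau v 2) ≠ 0 := by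
  intro h
  apply eval_numerator_ray_ne_zero hd hv 0
  have h2 := congrArg (eval (v 0)) h
  simp only [tau, map_sum, map_mul, pullback_X, map_zero, eval_affineNumerator] at h2
  rw [Finset.sum_eq_single 0 (fun j _ hj => by rw [eval_numerator_ray_of_ne hd v hj, mul_zero])
    (by simp)] at h2
  simpa [ray, ← algebraMap_eq] using h2

/-- The generic point of the Wachspress surface. -/
noncomputable def surfacePoint (hd : 4 ≤ d) (hv : NoThreeConcurrent v) : ProjSpace K d :=
  kernelPoint (pullback v) (exists_pullback_X_ne_zero hd hv)

theorem surface_eq_closure (hd : 4 ≤ d) (hv : NoThreeConcurrent v) :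
    surface v = closure {surfacePoint hd hv} := by
  apply Set.Subset.antisymm
  · refine closure_minimal ?_ isClosed_closure
    rintro _ ⟨⟨p, hp⟩, rfl⟩
    refine mem_closure_kernelPoint_iff.2 fun n f hf h0 => ?_
    refine Ideal.mem_homogeneousCore_of_homogeneous_of_mem ⟨n, hf⟩ ?_
    rw [Ideal.mem_comap, h0]
    exact zero_mem _
  -- The generic point `⊥` of the affine plane is mapped to `surfacePoint`.
  · refine closure_mono (Set.singleton_subset_iff.2 ⟨⟨⊥, ?_⟩, ?_⟩)
    · obtain ⟨i, hi⟩ := exists_pullback_X_ne_zero hd hv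
      exact ⟨i, by rw [← pullback_X]; simpa using hi⟩
    · rfl

theorem mem_surface_iff (hd : 4 ≤ d) (hv : NoThreeConcurrent v) {p : ProjSpace K d} :
    p ∈ surface v ↔ ∀ (n : ℕ) (f : MvPolynomial (ZMod d) K),
      f.IsHomogeneous n → pullback v f = 0 → f ∈ p.asHomogeneousIdeal := by
  rw [surface_eq_closure hd hv]
  exact mem_closure_kernelPoint_iff

theorem mem_quadrics_iff (hd : 4 ≤ d) (hv : NoThreeConcurrent v) {f : MvPolynomial (ZMod d) K} :
    f ∈ quadrics v ↔ f.IsHomogeneous 2 ∧ pullback v f = 0 := by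
  constructor
  · rintro ⟨h1, h2⟩
    refine ⟨h2, apply_eq_zero_of_mem_kernelPoint (h := exists_pullback_X_ne_zero hd hv) ?_⟩
    refine (ProjectiveSpectrum.mem_vanishingIdeal _ _).1 h1 _ ?_
    rw [surface_eq_closure hd hv]
    exact subset_closure rfl
  · rintro ⟨h1, h2⟩
    refine ⟨(ProjectiveSpectrum.mem_vanishingIdeal _ _).2 fun p hp => ?_, h1⟩
    exact (mem_surface_iff hd hv).1 hp 2 f h1 h2

theorem mem_quadricLocus_iff {p : ProjSpace K d} :
    p ∈ quadricLocus v ↔ ∀ f ∈ quadrics v, f ∈ p.asHomogeneousIdeal := by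
  rw [quadricLocus, ProjectiveSpectrum.zeroLocus_span]
  rfl

theorem mem_center_iff {p : ProjSpace K d} :
    p ∈ center v ↔ ∀ k, tau v k ∈ p.asHomogeneousIdeal :=
  Set.range_subset_iff

theorem surface_subset_quadricLocus (hd : 4 ≤ d) (hv : NoThreeConcurrent v) :
    surface v ⊆ quadricLocus v := fun _ hp =>
  mem_quadricLocus_iff.2 fun f hf =>
    (mem_surface_iff hd hv).1 hp 2 f hf.2 ((mem_quadrics_iff hd hv).1 hf).2

theorem center_subset_quadricLocus (hd : 4 ≤ d) (hv : NoThreeConcurrent v) :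
    center v ⊆ quadricLocus v := by
  intro p hp
  refine mem_quadricLocus_iff.2 fun f hf => ?_
  obtain ⟨h2, h0⟩ := (mem_quadrics_iff hd hv).1 hf
  obtain ⟨L, _, _, x, hx⟩ := exists_field_point p
  rw [hx]
  refine eval_quadric_eq_zero hd (hv.baseChange L) (h2.map _)
    (by rw [← map_pullback, h0, map_zero]) ?_
  funext k
  rw [← eval_tau, ← map_tau]
  exact (hx _).1 (mem_center_iff.1 hp k)

theorem quadricLocus_diff_center_subset (hd : 4 ≤ d) (hv : NoThreeConcurrent v) :
    quadricLocus v \ center v ⊆ surface v := by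
  rintro p ⟨hp, hpc⟩
  obtain ⟨L, _, _, x, hx⟩ := exists_field_point p
  refine (mem_surface_iff hd hv).2 fun n f hf h0 => (hx f).2 ?_
  have hτ : tauVec (baseChange L v) x ≠ 0 := by
    intro h
    refine hpc (mem_center_iff.2 fun k => (hx _).2 ?_)
    rw [map_tau, eval_tau, h]
    rfl
  refine eval_eq_zero_of_relations hd (hv.baseChange L) hτ (fun i => ?_) (hf.map _)
    (by rw [← map_pullback, h0, map_zero])
  have hq := mem_quadricLocus_iff.1 hp _ ((mem_quadrics_iff hd hv).2
    ⟨isHomogeneous_quadricForm v i, pullback_quadricForm hd v i⟩)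
  rw [hx, map_quadricForm, eval_quadricForm, sub_eq_zero] at hq
  exact hq

theorem not_surface_subset_center (hd : 4 ≤ d) (hv : NoThreeConcurrent v) :
    ¬ surface v ⊆ center v := by
  intro h
  have hmem : surfacePoint hd hv ∈ surface v := by
    rw [surface_eq_closure hd hv]
    exact subset_closure rfl
  exact pullback_tau_two_ne_zero hd hv
    (apply_eq_zero_of_mem_kernelPoint (mem_center_iff.1 (h hmem) 2))

theorem not_center_subset_surface (hd : 6 ≤ d) (hv : NoThreeConcurrent v) :
    ¬ center v ⊆ surface v := by
  intro h
  obtain ⟨x, f, hx, hf, h0, hne⟩ := exists_cubic_eval_ne_zero hd hv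
  have hX : ∃ i, aeval x (X i : MvPolynomial (ZMod d) K) ≠ 0 := by
    by_contra! hcon
    have : x = (0 : K) • x := by
      funext i
      simpa using hcon i
    apply hne
    rw [this, ← aeval_eq_eval, aeval_smul_of_isHomogeneous hf]
    simp
  have hc : kernelPoint (aeval x) hX ∈ center v := by
    refine mem_center_iff.2 fun k => (mem_kernelPoint_iff (isHomogeneous_tau v k)).2 ?_
    rw [aeval_eq_eval, eval_tau, hx]
    rfl
  apply hne
  rw [← aeval_eq_eval]
  exact (mem_kernelPoint_iff hf).1 ((mem_surface_iff (by omega) hv).1 (h hc) 3 f hf h0)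

/-- The linear map `x ↦ ∑ᵢ xᵢ (vᵢ, 1)`. -/
def tauLin (v : ZMod d → Fin 2 → K) : (ZMod d → K) →ₗ[K] (Fin 3 → K) where
  toFun := tauVec v
  map_add' := tauVec_add v
  map_smul' := tauVec_smul v

theorem tauLin_surjective (hd : 4 ≤ d) (hv : NoThreeConcurrent v) :
    Function.Surjective (tauLin v) := by
  intro u
  set M := Matrix.of ![ray v (0 - 1), ray v 0, ray v (0 + 1)] with hM
  have hdet : M.det ≠ 0 := hv.alpha_ne_zero hd 0
  set c := Matrix.vecMul u M⁻¹ with hc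
  have hcM : Matrix.vecMul c M = u := by
    rw [hc, Matrix.vecMul_vecMul, Matrix.nonsing_inv_mul _ hdet.isUnit, Matrix.vecMul_one]
  refine ⟨Pi.single (0 - 1) (c 0) + Pi.single 0 (c 1) + Pi.single (0 + 1) (c 2), ?_⟩
  change tauVec v _ = u
  rw [tauVec_add, tauVec_add, tauVec_single, tauVec_single, tauVec_single, ← hcM]
  funext k
  simp [Matrix.vecMul, dotProduct, Fin.sum_univ_three, hM]

/-- The center is the closure of a point: the kernel of the comorphism of a linear projection onto
the kernel of `τ`. -/
theorem exists_center_eq_closure (hd : 4 ≤ d) (hv : NoThreeConcurrent v) :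
    ∃ g : ProjSpace K d, center v = closure {g} := by
  obtain ⟨σ, hσ⟩ := (tauLin v).exists_rightInverse_of_surjective
    (LinearMap.range_eq_top.2 (tauLin_surjective hd hv))
  set s : ZMod d → Fin 3 → K := fun i k => σ (Pi.single k 1) i with hs
  have hrs : ∀ l k, ∑ i, ray v i l * s i k = if l = k then 1 else 0 := by
    intro l k
    have h := congrFun (LinearMap.congr_fun hσ (Pi.single k 1)) l
    simp only [LinearMap.comp_apply, LinearMap.id_apply] at h
    change tauVec v _ l = _ at h
    simp only [tauVec, Finset.sum_apply, Pi.smul_apply, smul_eq_mul, Pi.single_apply] at h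
    rw [← h]
    exact Finset.sum_congr rfl fun i _ => mul_comm _ _
  -- These are the coordinates of the projection `x ↦ x - σ(τ x)` onto `ker τ`; it fixes every
  -- vector of `ker τ`.
  set y : ZMod d → MvPolynomial (ZMod d) K := fun i => X i - ∑ k, C (s i k) * tau v k with hy
  have hφτ : ∀ l, aeval y (tau v l) = 0 := by
    intro l
    have h1 : aeval y (tau v l) = ∑ i, C (ray v i l) * y i := by simp [tau, algebraMap_eq]
    have h2 : ∑ i, C (ray v i l) * ∑ k, C (s i k) * tau v k = tau v l := by
      simp only [Finset.mul_sum, ← mul_assoc, ← C_mul]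
      rw [Finset.sum_comm]
      simp only [← Finset.sum_mul, ← map_sum, hrs]
      simp
    rw [h1]
    simp only [hy, mul_sub, Finset.sum_sub_distrib]
    rw [h2, tau, sub_self]
  -- As `d ≥ 4`, `ker τ` contains a nonzero vector, and the projection fixes it, so the forms `y i`
  -- are not all zero.
  have hX : ∃ i, aeval y (X i : MvPolynomial (ZMod d) K) ≠ 0 := by
    by_contra! hcon
    have hker : LinearMap.ker (tauLin v) ≠ ⊥ :=
      LinearMap.ker_ne_bot_of_finrank_lt (by simp [ZMod.card]; omega)
    obtain ⟨x, hx, hx0⟩ := Submodule.exists_mem_ne_zero_of_ne_bot hker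
    apply hx0
    funext i
    have hxτ : tauVec v x = 0 := hx
    have h := congrArg (eval x) (hcon i)
    simpa [hy, eval_tau, hxτ] using h
  refine ⟨kernelPoint (aeval y) hX, Set.Subset.antisymm ?_ ?_⟩
  · intro p hp
    refine mem_closure_kernelPoint_iff.2 fun n f hf h0 => ?_
    obtain ⟨L, _, _, x, hx⟩ := exists_field_point p
    rw [hx]
    have hτ : ∀ k, aeval x (tau v k) = 0 := fun k => by
      rw [aeval_def, ← eval_map]
      exact (hx _).1 (mem_center_iff.1 hp k)
    have hxy : (fun i => aeval x (y i)) = x := by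
      funext i
      simp [hy, hτ]
    have h := congrArg (aeval x) h0
    rw [map_zero, ← AlgHom.comp_apply, comp_aeval, hxy] at h
    rw [eval_map, ← aeval_def, h]
  · refine closure_minimal (Set.singleton_subset_iff.2 ?_)
      (ProjectiveSpectrum.isClosed_zeroLocus _ _)
    exact mem_center_iff.2 fun k => (mem_kernelPoint_iff (isHomogeneous_tau v k)).2 (hφτ k)

end Main

end Wachspress

theorem theorem3p14 {K : Type*} [Field K] {d : ℕ} [NeZero d] (hd : 4 ≤ d)
    (v : ZMod d → Fin 2 → K) (hv : Wachspress.NoThreeConcurrent v) :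
    Wachspress.quadricLocus v \ Wachspress.center v ⊆ Wachspress.surface v ∧
    Wachspress.quadricLocus v = Wachspress.surface v ∪ Wachspress.center v ∧
    (IsClosed (Wachspress.surface v) ∧ IsIrreducible (Wachspress.surface v)) ∧
    (IsClosed (Wachspress.center v) ∧ IsIrreducible (Wachspress.center v)) ∧
    ¬ Wachspress.surface v ⊆ Wachspress.center v ∧
    (6 ≤ d →
      ¬ Wachspress.center v ⊆ Wachspress.surface v ∧
      (fun Z : Set (Wachspress.quadricLocus v) => Subtype.val '' Z) ''
          irreducibleComponents (Wachspress.quadricLocus v) =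
        {Wachspress.surface v, Wachspress.center v}) := by
  have hsub := Wachspress.quadricLocus_diff_center_subset hd hv
  have hnot := Wachspress.not_surface_subset_center hd hv
  have hunion : Wachspress.quadricLocus v = Wachspress.surface v ∪ Wachspress.center v := by
    refine Set.Subset.antisymm (fun p hp => ?_) (Set.union_subset
      (Wachspress.surface_subset_quadricLocus hd hv)
      (Wachspress.center_subset_quadricLocus hd hv))
    by_cases hc : p ∈ Wachspress.center v
    · exact Or.inr hc
    · exact Or.inl (hsub ⟨hp, hc⟩)
  obtain ⟨c, hc⟩ := Wachspress.exists_center_eq_closure hd hv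
  have hs := Wachspress.surface_eq_closure hd hv
  refine ⟨hsub, hunion, ⟨isClosed_closure, ?_⟩, ⟨?_, ?_⟩, hnot, fun hd6 => ?_⟩
  · rw [hs]
    exact isIrreducible_singleton.closure
  · rw [hc]
    exact isClosed_closure
  · rw [hc]
    exact isIrreducible_singleton.closure
  · have hnot' := Wachspress.not_center_subset_surface hd6 hv
    refine ⟨hnot', ?_⟩
    rw [hs, hc] at hunion hnot hnot' ⊢
    exact Wachspress.irreducibleComponents_image_eq_pair hunion hnot hnot'
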